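/- Let $\mathbb{k}$ be $\mathbb{R}$ or $\mathbb{C}$, let $n \ge 0$, and let $\Omega_n = \mathbb{k}[x_1,\dots,x_n]\otimes\bigwedge \mathbb{k}^n$ be the algebra of differential forms on $n$-space with polynomial coefficients, where $dx_1,\dots,dx_n$ is the standard basis of $\mathbb{k}^n$. Give $\Omega_n$ the total degree with $\deg x_i=\deg dx_i=1$, and let $S_n$ act on it by permuting the indices of the $x_i$ and of the $dx_i$ simultaneously. Put on $\Omega_n$ the inner product for which the monomial forms $x^a\,dx_{i_1}\wedge\cdots\wedge dx_{i_k}$ ($a\in\mathbb{N}^n$, $i_1<\dots<i_k$) are pairwise orthogonal with $\langle x^a\,dx_{i_1}\wedge\cdots\wedge dx_{i_k},\,x^a\,dx_{i_1}\wedge\cdots\wedge dx_{i_k}\rangle=a_1!\cdots a_n!$. A form is called harmonic if it is orthogonal to the ideal of $\Omega_n$ generated by all homogeneous $S_n$-invariant forms of positive total degree. Then every harmonic element of $\Omega_n$ has total degree at most $\binom n2$. If moreover $n\ge 2$, then the space of harmonic forms that are homogeneous of total degree $\binom n2$ is two-dimensional, with basis $\Delta,\ d\Delta$, where $\Delta=\prod_{1\le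 i<j\le n}(x_i-x_j)$ and $d\Delta=\sum_{i}\frac{\partial\Delta}{\partial x_i}\,dx_i$. -/

import Mathlib

open scoped TensorProduct Nat

noncomputable section

namespace PolyForm

/-- The algebra `𝕜[x₁, …, xₙ] ⊗ ⋀ 𝕜ⁿ` of differential forms on `n`-space with polynomial
coefficients; the two tensor factors commute, and `dxᵢ` is the `i`-th basis vector of `𝕜ⁿ`
in the exterior algebra. -/
abbrev Form (𝕜 : Type*) [RCLike 𝕜] (n : ℕ) : Type _ :=
  MvPolynomial (Fin n) 𝕜 ⊗[𝕜] ExteriorAlgebra 𝕜 (Fin n → 𝕜)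

/-- The basis of monomial forms `x^a dx_{i₁} ∧ ⋯ ∧ dx_{i_k}`, indexed by the exponent `a`
and the set `{i₁ < ⋯ < i_k}`. -/
def monomialBasis (𝕜 : Type*) [RCLike 𝕜] (n : ℕ) :
    Module.Basis ((Fin n →₀ ℕ) × Finset (Fin n)) 𝕜 (Form 𝕜 n) :=
  (MvPolynomial.basisMonomials (Fin n) 𝕜).tensorProduct (Pi.basisFun 𝕜 (Fin n)).ExteriorAlgebra

/-- The total degree of a monomial form, with `deg xᵢ = deg dxᵢ = 1`. -/
def monomialDegree {n : ℕ} (b : (Fin n →₀ ℕ) × Finset (Fin n)) : ℕ :=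
  b.1.degree + b.2.card

/-- The total degree of a form: the largest degree of a monomial form that occurs in it
(and `0` for the zero form). -/
def totalDegree {𝕜 : Type*} [RCLike 𝕜] {n : ℕ} (ω : Form 𝕜 n) : ℕ :=
  ((monomialBasis 𝕜 n).repr ω).support.sup monomialDegree

/-- The space of forms that are homogeneous of total degree `m`. -/
def homogeneous (𝕜 : Type*) [RCLike 𝕜] (n m : ℕ) : Submodule 𝕜 (Form 𝕜 n) :=
  Submodule.span 𝕜 (monomialBasis 𝕜 n '' {b | monomialDegree b = m})

/-- The diagonal action of a permutation: `xᵢ ↦ x_{σ i}` and `dxᵢ ↦ dx_{σ i}`. -/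
def permAct (𝕜 : Type*) [RCLike 𝕜] {n : ℕ} (σ : Equiv.Perm (Fin n)) :
    Form 𝕜 n →ₐ[𝕜] Form 𝕜 n :=
  Algebra.TensorProduct.map (MvPolynomial.rename σ)
    (ExteriorAlgebra.map (LinearMap.funLeft 𝕜 𝕜 σ.symm))

/-- The ideal generated by the homogeneous `Sₙ`-invariant forms of positive total degree. -/
def invariantIdeal (𝕜 : Type*) [RCLike 𝕜] (n : ℕ) : TwoSidedIdeal (Form 𝕜 n) :=
  TwoSidedIdeal.span
    {η | (∀ σ : Equiv.Perm (Fin n), permAct 𝕜 σ η = η) ∧ ∃ m, 0 < m ∧ η ∈ homogeneous 𝕜 n m}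

/-- The inner product on forms: the tensor product of the usual inner product on polynomials,
`⟨f, g⟩ = (f̄(∂) g)(0)`, for which distinct monomials are orthogonal and `⟨x^a, x^a⟩ = a!`, with
the inner product on `⋀ 𝕜ⁿ` for which the `dx_{i₁} ∧ ⋯ ∧ dx_{i_k}` (`i₁ < ⋯ < i_k`) are
orthonormal. It is conjugate-linear in the first variable. -/
def innerProd {𝕜 : Type*} [RCLike 𝕜] {n : ℕ} (η ω : Form 𝕜 n) : 𝕜 :=
  ((monomialBasis 𝕜 n).repr ω).sum fun b c =>
    ((∏ i, (b.1 i)! : ℕ) : 𝕜) * star ((monomialBasis 𝕜 n).repr η b) * c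

/-- The space of harmonic forms: the orthogonal complement of the ideal generated by the
homogeneous invariants of positive total degree. -/
def harmonic (𝕜 : Type*) [RCLike 𝕜] (n : ℕ) : Submodule 𝕜 (Form 𝕜 n) where
  carrier := {ω | ∀ η ∈ invariantIdeal 𝕜 n, innerProd η ω = 0}
  zero_mem' := by
    intro η _
    simp [innerProd]
  add_mem' := by
    intro ω₁ ω₂ h₁ h₂ η hη
    have e : innerProd η (ω₁ + ω₂) = innerProd η ω₁ + innerProd η ω₂ := by
      unfold innerProd
      rw [map_add]
      exact Finsupp.sum_add_index' (by simp) (by intros; ring)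
    rw [e, h₁ η hη, h₂ η hη, add_zero]
  smul_mem' := by
    intro c ω h η hη
    have e : innerProd η (c • ω) = c * innerProd η ω := by
      unfold innerProd
      rw [map_smul, Finsupp.sum_smul_index (by simp), Finsupp.mul_sum]
      exact Finsupp.sum_congr (by intros; ring)
    rw [e, h η hη, mul_zero]

/-- The exterior derivative, `d (f α) = ∑ᵢ (∂f/∂xᵢ) dxᵢ ∧ α`. -/
def extDeriv (𝕜 : Type*) [RCLike 𝕜] (n : ℕ) : Form 𝕜 n →ₗ[𝕜] Form 𝕜 n :=
  ∑ i : Fin n, TensorProduct.map (MvPolynomial.pderiv i).toLinearMap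
    (LinearMap.mulLeft 𝕜 (ExteriorAlgebra.ι 𝕜 (Pi.single i (1 : 𝕜))))

/-- The Vandermonde determinant `Δ = ∏_{i < j} (xᵢ - xⱼ)`, as a form of degree `0`
in the `dxᵢ`. -/
def vandermonde (𝕜 : Type*) [RCLike 𝕜] (n : ℕ) : Form 𝕜 n :=
  (∏ i : Fin n, ∏ j ∈ Finset.Ioi i, (MvPolynomial.X i - MvPolynomial.X j)) ⊗ₜ[𝕜] 1

end PolyForm

end

/-!
A form is harmonic when it is orthogonal to the ideal `I` generated by the positive invariants, so
its coefficient at `dx_K` is orthogonal to the ideal `annihilator 𝕜 K` of all polynomials `f` with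
`f dx_K ∈ I`. The proof bounds the space of harmonic forms from above by showing that these ideals
are large, and from below by showing that `Δ` and `dΔ` are orthogonal to `I`.

*Upper bound.* The ideal `annihilator 𝕜 K` contains the elementary symmetric polynomials and, since
`∑ xⱼ^m dxⱼ` is invariant for every `m`, the products `∏_{l ∉ J} (xᵢ - x_l)` for `i ∈ J ⊆ K`
(`hasRelations_annihilator`). Modulo the elementary symmetric polynomials
`∏_{l ∉ J} (1 - x_l T) = ∑ h_m(x_J) T^m`, which turns these relations into relations between complete
homogeneous polynomials. Order the variables such that `K` comes last. Then `xⱼ` has a relation with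
leading term `xⱼ^(j+1)`, or `xⱼ^j` if `j ∈ K`, in the variables `xⱼ, xⱼ₊₁, …` (numbered from `0`).
Hence polynomials of degree more than `C(n,2) - |K|` vanish modulo the annihilator, and a single
monomial spans degree `C(n,2) - |K|`. If `|K| ≥ 2`, that monomial vanishes as well: the relations
`∑ (j+1) x^j y^(n-2-j) = 0`, its mirror image, and `x^(n-1) = y^(n-1) = 0` for the last two variables
give two independent equations between `x^(n-2) y^(n-3)` and `x^(n-3) y^(n-2)` (for `n = 2` the
annihilator is everything). See `HasRelations.exists_top`.

*Lower bound.* The algebra homomorphism `toDual` to the dual numbers, `xᵢ ↦ xᵢ`, `dxᵢ ↦ xᵢ ε`, is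
equivariant and preserves the total degree, so it maps `I` to dual numbers with both parts in the ideal
generated by the positive symmetric polynomials. Pairing a form with `Δ` or `dΔ` amounts to pairing one
of these two parts with `Δ`. That ideal is orthogonal to `Δ`: the second factor of a product
`f h`, `f` symmetric, may be antisymmetrized, and antisymmetric polynomials have no terms of
degree less than `C(n,2)` (`polyInner_vandermonde_eq_zero`).

*Conclusion.* By the upper bound a harmonic form of degree `C(n,2)` is
`r Δ + ∑ sᵢ (∂Δ/∂xᵢ) dxᵢ`. It is orthogonal to the multiples of `∑ dxᵢ`, so
`∑ sᵢ ∂Δ/∂xᵢ = 0`, which forces all `sᵢ` to be equal (`eq_of_sum_smul_pderiv_eq_zero`).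
-/

noncomputable section

namespace PolyForm

open MvPolynomial

/-! ### Complete homogeneous and elementary symmetric polynomials -/

section CompleteHomogeneous

variable {ι Q : Type*} [CommRing Q]

/-- The complete homogeneous symmetric polynomial of degree `m` in the elements `x i`, `i ∈ s`. -/
def completeHomog [DecidableEq ι] (x : ι → Q) (s : Finset ι) (m : ℕ) : Q :=
  ∑ c ∈ s.finsuppAntidiag m, ∏ i ∈ s, x i ^ c i

/-- The power series `∏_{i ∈ s} (1 - x i T)`. -/
def elemSeries (x : ι → Q) (s : Finset ι) : PowerSeries Q :=
  ∏ i ∈ s, (1 - PowerSeries.C (x i) * PowerSeries.X)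

lemma one_sub_mul_mk_pow (y : Q) :
    (1 - PowerSeries.C y * PowerSeries.X) * PowerSeries.mk (fun m => y ^ m) = 1 := by
  ext m
  cases m with
  | zero => simp
  | succ m => 
    rw [sub_mul, one_mul, mul_assoc, map_sub, PowerSeries.coeff_C_mul, PowerSeries.coeff_succ_X_mul]
    simp [pow_succ', PowerSeries.coeff_one]

lemma elemSeries_mul_mk_completeHomog [DecidableEq ι] (x : ι → Q) (s : Finset ι) :
    elemSeries x s * PowerSeries.mk (completeHomog x s) = 1 := by
  have h : PowerSeries.mk (completeHomog x s) =
      ∏ i ∈ s, PowerSeries.mk (fun m => x i ^ m) := by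
    ext m
    simp [PowerSeries.coeff_prod, completeHomog]
  rw [h, elemSeries, ← Finset.prod_mul_distrib]
  exact Finset.prod_eq_one fun i _ => one_sub_mul_mk_pow _

lemma coeff_elemSeries_insert [DecidableEq ι] (x : ι → Q) {s : Finset ι} {a : ι} (ha : a ∉ s)
    (m : ℕ) :
    PowerSeries.coeff (m + 1) (elemSeries x (insert a s)) =
      PowerSeries.coeff (m + 1) (elemSeries x s) - x a * PowerSeries.coeff m (elemSeries x s) := by
  rw [elemSeries, Finset.prod_insert ha, sub_mul, one_mul, mul_assoc, map_sub,
    PowerSeries.coeff_C_mul, PowerSeries.coeff_succ_X_mul]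
  rfl

lemma coeff_zero_elemSeries (x : ι → Q) (s : Finset ι) :
    PowerSeries.coeff 0 (elemSeries x s) = 1 := by
  simp [elemSeries, map_prod]

lemma coeff_elemSeries_eq_zero [DecidableEq ι] (x : ι → Q) (s : Finset ι) :
    ∀ m, s.card < m → PowerSeries.coeff m (elemSeries x s) = 0 := by
  induction s using Finset.induction_on with
  | empty =>
    intro m hm
    simp only [Finset.card_empty] at hm
    simp [elemSeries, PowerSeries.coeff_one, hm.ne']
  | insert a s ha ih =>
    intro m hm
    rw [Finset.card_insert_of_notMem ha] at hm
    obtain ⟨m, rfl⟩ : ∃ k, m = k + 1 := ⟨m - 1, by omega⟩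
    rw [coeff_elemSeries_insert x ha, ih _ (by omega), ih _ (by omega)]
    simp

/-- `∏ (y - x l)` is the homogenization of the series `∏ (1 - x l T)`, a polynomial in `T`. -/
lemma prod_sub_eq_sum_coeff [DecidableEq ι] (x : ι → Q) (y : Q) (s : Finset ι) :
    ∏ l ∈ s, (y - x l) = ∑ m ∈ Finset.range (s.card + 1),
      PowerSeries.coeff m (elemSeries x s) * y ^ (s.card - m) := by
  induction s using Finset.induction_on with
  | empty => simp [elemSeries]
  | insert a s ha ih =>
    have hl : ∑ m ∈ Finset.range (s.card + 1),
        PowerSeries.coeff (m + 1) (elemSeries x s) * y ^ (s.card - m) =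
        y * ∑ m ∈ Finset.range (s.card + 1),
          PowerSeries.coeff m (elemSeries x s) * y ^ (s.card - m) - y ^ (s.card + 1) := by
      rw [Finset.sum_range_succ, coeff_elemSeries_eq_zero x s _ (Nat.lt_succ_self _),
        Finset.sum_range_succ' (n := s.card), coeff_zero_elemSeries, mul_add, Finset.mul_sum]
      rw [zero_mul, add_zero, one_mul, Nat.sub_zero, pow_succ' y s.card, add_sub_cancel_right]
      refine Finset.sum_congr rfl fun m hm => ?_
      have : s.card - m = s.card - (m + 1) + 1 := by
        have := Finset.mem_range.1 hm
        omega
      rw [this, pow_succ]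
      ring
    rw [Finset.prod_insert ha, ih, Finset.card_insert_of_notMem ha, Finset.sum_range_succ' _ (_ + 1),
      coeff_zero_elemSeries]
    simp only [coeff_elemSeries_insert x ha, sub_mul, Finset.sum_sub_distrib, Nat.add_sub_add_right,
      hl, Nat.sub_zero, mul_assoc, ← Finset.mul_sum]
    ring

section

variable [Fintype ι] [DecidableEq ι]

/-- If `∏ (1 - x i T) = 1`, the elementary symmetric polynomials in the variables outside `s` are,
up to sign, the complete homogeneous ones in the variables of `s`. -/
lemma coeff_elemSeries_compl {x : ι → Q} (hx : elemSeries x Finset.univ = 1) (s : Finset ι)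
    (m : ℕ) : PowerSeries.coeff m (elemSeries x sᶜ) = completeHomog x s m := by
  have h₁ : elemSeries x s * elemSeries x sᶜ = 1 := by
    rw [← hx]
    exact Finset.prod_mul_prod_compl s _
  have h₂ := elemSeries_mul_mk_completeHomog x s
  have : elemSeries x sᶜ = PowerSeries.mk (completeHomog x s) := by
    calc elemSeries x sᶜ = elemSeries x sᶜ *
          (elemSeries x s * PowerSeries.mk (completeHomog x s)) := by rw [h₂, mul_one]
      _ = elemSeries x s * elemSeries x sᶜ * PowerSeries.mk (completeHomog x s) := by ring
      _ = _ := by rw [h₁, one_mul]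
  rw [this, PowerSeries.coeff_mk]

lemma completeHomog_eq_zero {x : ι → Q} (hx : elemSeries x Finset.univ = 1) {s : Finset ι}
    {m : ℕ} (hm : sᶜ.card < m) : completeHomog x s m = 0 := by
  rw [← coeff_elemSeries_compl hx, coeff_elemSeries_eq_zero x _ _ hm]

lemma prod_compl_sub {x : ι → Q} (hx : elemSeries x Finset.univ = 1) (s : Finset ι) (y : Q) :
    ∏ l ∈ sᶜ, (y - x l) =
      ∑ m ∈ Finset.range (sᶜ.card + 1), completeHomog x s m * y ^ (sᶜ.card - m) := by
  simp_rw [prod_sub_eq_sum_coeff, coeff_elemSeries_compl hx]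

end

variable [DecidableEq ι]

lemma completeHomog_zero (x : ι → Q) (s : Finset ι) : completeHomog x s 0 = 1 := by
  simp [completeHomog]

lemma completeHomog_singleton (x : ι → Q) (i : ι) (m : ℕ) :
    completeHomog x {i} m = x i ^ m := by
  have h := elemSeries_mul_mk_completeHomog x {i}
  have h' := one_sub_mul_mk_pow (x i)
  rw [elemSeries, Finset.prod_singleton] at h
  have : PowerSeries.mk (completeHomog x {i}) = PowerSeries.mk (fun m => x i ^ m) := by
    calc _ = PowerSeries.mk (completeHomog x {i}) * ((1 - PowerSeries.C (x i) * PowerSeries.X) *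
            PowerSeries.mk (fun m => x i ^ m)) := by rw [h', mul_one]
      _ = ((1 - PowerSeries.C (x i) * PowerSeries.X) * PowerSeries.mk (completeHomog x {i})) *
            PowerSeries.mk (fun m => x i ^ m) := by ring
      _ = _ := by rw [h, one_mul]
  simpa using congrArg (PowerSeries.coeff m) this

lemma completeHomog_insert (x : ι → Q) {s : Finset ι} {a : ι} (ha : a ∉ s) (m : ℕ) :
    completeHomog x (insert a s) (m + 1) =
      completeHomog x s (m + 1) + x a * completeHomog x (insert a s) m := by
  have h := elemSeries_mul_mk_completeHomog x (insert a s)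
  have h' := elemSeries_mul_mk_completeHomog x s
  rw [elemSeries, Finset.prod_insert ha] at h
  have : (1 - PowerSeries.C (x a) * PowerSeries.X) *
      PowerSeries.mk (completeHomog x (insert a s)) = PowerSeries.mk (completeHomog x s) := by
    calc _ = (1 - PowerSeries.C (x a) * PowerSeries.X) *
          PowerSeries.mk (completeHomog x (insert a s)) *
            (elemSeries x s * PowerSeries.mk (completeHomog x s)) := by rw [h', mul_one]
      _ = ((1 - PowerSeries.C (x a) * PowerSeries.X) * elemSeries x s) *
          PowerSeries.mk (completeHomog x (insert a s)) * PowerSeries.mk (completeHomog x s) := by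
          ring
      _ = _ := by rw [elemSeries, h, one_mul]
  have := congrArg (PowerSeries.coeff (m + 1)) this
  rw [sub_mul, one_mul, mul_assoc, map_sub, PowerSeries.coeff_C_mul,
    PowerSeries.coeff_succ_X_mul, PowerSeries.coeff_mk, PowerSeries.coeff_mk,
    PowerSeries.coeff_mk] at this
  rw [← this]
  ring

lemma map_completeHomog {R : Type*} [CommRing R] (f : R →+* Q) (x : ι → R) (s : Finset ι) (m : ℕ) :
    f (completeHomog x s m) = completeHomog (fun i => f (x i)) s m := by
  simp [completeHomog, map_sum, map_prod]

omit [DecidableEq ι] in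
lemma map_elemSeries {R : Type*} [CommRing R] (f : R →+* Q) (x : ι → R) (s : Finset ι) :
    PowerSeries.map f (elemSeries x s) = elemSeries (fun i => f (x i)) s := by
  simp [elemSeries, map_prod]

omit [DecidableEq ι] in
lemma map_coeff_elemSeries {R : Type*} [CommRing R] (f : R →+* Q) (x : ι → R) (s : Finset ι)
    (m : ℕ) : f (PowerSeries.coeff m (elemSeries x s)) =
      PowerSeries.coeff m (elemSeries (fun i => f (x i)) s) := by
  rw [← map_elemSeries, PowerSeries.coeff_map]

omit [DecidableEq ι] in
lemma elemSeries_univ_comp_perm [Fintype ι] (x : ι → Q) (ρ : Equiv.Perm ι) :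
    elemSeries (fun i => x (ρ i)) Finset.univ = elemSeries x Finset.univ :=
  Equiv.prod_comp ρ fun i => 1 - PowerSeries.C (x i) * PowerSeries.X

omit [DecidableEq ι] in
lemma rename_coeff_elemSeries {F : Type*} [CommRing F] [Fintype ι] (ρ : Equiv.Perm ι) (m : ℕ) :
    rename ρ (PowerSeries.coeff m (elemSeries (X : ι → MvPolynomial ι F) Finset.univ)) =
      PowerSeries.coeff m (elemSeries X Finset.univ) := by
  have := map_coeff_elemSeries (rename (R := F) ρ).toRingHom X Finset.univ m
  simp only [AlgHom.toRingHom_eq_coe, RingHom.coe_coe, rename_X] at this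
  rw [this, elemSeries_univ_comp_perm]

variable {F : Type*} [Field F]

lemma isHomogeneous_completeHomog (s : Finset ι) (m : ℕ) :
    (completeHomog (X : ι → MvPolynomial ι F) s m).IsHomogeneous m := by
  refine IsHomogeneous.sum _ _ _ fun c hc => ?_
  rw [← (Finset.mem_finsuppAntidiag.1 hc).1]
  refine IsHomogeneous.prod _ _ _ fun i _ => ?_
  simpa using (isHomogeneous_X F i).pow (c i)

lemma completeHomog_mem_supported (s : Finset ι) (m : ℕ) :
    completeHomog (X : ι → MvPolynomial ι F) s m ∈ supported F (s : Set ι) :=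
  sum_mem fun _ _ => prod_mem fun _ hi => pow_mem (X_mem_supported.2 hi) _

lemma coeff_single_completeHomog {s : Finset ι} {j : ι} (hj : j ∈ s) (m : ℕ) :
    coeff (Finsupp.single j m) (completeHomog (X : ι → MvPolynomial ι F) s m) = 1 := by
  have h : completeHomog (X : ι → MvPolynomial ι F) s m =
      ∑ c ∈ s.finsuppAntidiag m, monomial c 1 := by
    refine Finset.sum_congr rfl fun c hc => ?_
    rw [monomial_eq, map_one, one_mul,
      Finsupp.prod_of_support_subset _ (Finset.mem_finsuppAntidiag.1 hc).2 _ (by simp)]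
  rw [h, coeff_sum]
  simp_rw [coeff_monomial]
  rw [Finset.sum_ite_eq', if_pos]
  rw [Finset.mem_finsuppAntidiag]
  refine ⟨?_, Finsupp.support_single_subset.trans (by simpa using hj)⟩
  rw [Finset.sum_eq_single_of_mem j hj fun b _ hb => Finsupp.single_eq_of_ne hb]
  simp

end CompleteHomogeneous

/-- With `y ^ (N + 2) = 0` only the two terms of lowest degree in `y` of the complete homogeneous
polynomials in `x, y` survive multiplication by `y ^ N`. -/
lemma pair_relation {Q : Type*} [CommRing Q] (x y : Q) (N : ℕ) (h : ℕ → Q) (h0 : h 0 = 1)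
    (hs : ∀ m, h (m + 1) = x ^ (m + 1) + y * h m) (hy : y ^ (N + 2) = 0)
    (hsum : ∑ m ∈ Finset.range (N + 2), h m * x ^ (N + 1 - m) = 0) :
    ((N : Q) + 2) * (x ^ (N + 1) * y ^ N) + ((N : Q) + 1) * (x ^ N * y ^ (N + 1)) = 0 := by
  have hterm : ∀ m ∈ Finset.range (N + 1), h (m + 1) * x ^ (N + 1 - (m + 1)) * y ^ N =
      x ^ (N + 1) * y ^ N + x ^ N * y ^ (N + 1) := by
    intro m hm
    have hm' : m ≤ N := Nat.lt_succ_iff.1 (Finset.mem_range.1 hm)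
    obtain ⟨k, rfl⟩ := Nat.exists_eq_add_of_le hm'
    have e : m + k + 1 - (m + 1) = k := by omega
    rw [e, hs]
    have h2 : y * h m * x ^ k * y ^ (m + k) = x ^ (m + k) * y ^ (m + k + 1) := by
      cases m with
      | zero => rw [h0]; ring
      | succ m =>
        rw [hs]
        linear_combination h m * x ^ k * hy
    linear_combination h2
  have := congrArg (· * y ^ N) hsum
  simp only [Finset.sum_mul, zero_mul] at this
  rw [Finset.sum_range_succ', Finset.sum_congr rfl hterm] at this
  simp only [Finset.sum_const, Finset.card_range, nsmul_eq_mul, h0, Nat.sub_zero] at this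
  push_cast at this
  linear_combination this

/-! ### Reduction of monomials modulo the relations -/

section Reduction

variable {F : Type*} [Field F] {n : ℕ}

/-- Division by polynomials `p_j` in the variables `X_j, X_{j+1}, …`, homogeneous of degree `b j`,
in which `X_j ^ b j` occurs: every monomial reduces to those with all exponents below `b`. -/
lemma monomial_mem_sup_span (A : Ideal (MvPolynomial (Fin n) F)) (b : Fin n → ℕ)
    (h : ∀ j, ∃ p ∈ A, p.IsHomogeneous (b j) ∧ (∀ c ∈ p.support, ∀ l < j, c l = 0) ∧
      coeff (Finsupp.single j (b j)) p ≠ 0) (a : Fin n →₀ ℕ) :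
    monomial a (1 : F) ∈ A.restrictScalars F ⊔ Submodule.span F
      ((fun c => monomial c (1 : F)) '' {c : Fin n →₀ ℕ | c.degree = a.degree ∧ ∀ j, c j < b j}) := by
  have wf : WellFounded (fun a b : Fin n →₀ ℕ => toLex a < toLex b) :=
    InvImage.wf toLex (wellFounded_lt (α := Lex (Fin n →₀ ℕ)))
  induction a using wf.induction with
  | _ a ih =>
  by_cases hb : ∀ j, a j < b j
  · exact Submodule.mem_sup_right (Submodule.subset_span ⟨a, ⟨rfl, hb⟩, rfl⟩)
  push Not at hb
  obtain ⟨j, hj⟩ := hb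
  obtain ⟨p, hpA, hph, hpl, hpc⟩ := h j
  set e := Finsupp.single j (b j) with he
  have hle : e ≤ a := Finsupp.single_le_iff.2 hj
  set V := A.restrictScalars F ⊔ Submodule.span F
      ((fun c => monomial c (1 : F)) '' {c : Fin n →₀ ℕ | c.degree = a.degree ∧ ∀ j, c j < b j})
    with hV
  have hmem : monomial (a - e) 1 * p ∈ V := Submodule.mem_sup_left (A.mul_mem_left _ hpA)
  have hexp : monomial (a - e) 1 * p = coeff e p • monomial a (1 : F) +
      ∑ c ∈ p.support.erase e, coeff c p • monomial (a - e + c) (1 : F) := by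
    have h0 : ∀ c, monomial (a - e) 1 * monomial c (coeff c p) =
        coeff c p • monomial (a - e + c) (1 : F) := fun c => by
      rw [monomial_mul, smul_monomial, smul_eq_mul, mul_one, one_mul]
    conv_lhs => rw [p.as_sum, Finset.mul_sum]
    simp_rw [h0]
    rw [← Finset.add_sum_erase _ _ (mem_support_iff.2 hpc), tsub_add_cancel_of_le hle]
  have hrest : ∑ c ∈ p.support.erase e, coeff c p • monomial (a - e + c) (1 : F) ∈ V := by
    refine Submodule.sum_mem _ fun c hc => Submodule.smul_mem _ _ ?_
    obtain ⟨hce, hcs⟩ := Finset.mem_erase.1 hc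
    have hdeg : c.degree = b j := by
      have := hph (mem_support_iff.1 hcs)
      rw [Finsupp.degree_eq_weight_one]
      exact this
    have hcj : c j < b j := by
      have hle' : c j ≤ b j := hdeg ▸ Finsupp.le_degree j c
      refine lt_of_le_of_ne hle' fun hcj => hce ?_
      have h1 : Finsupp.single j (b j) ≤ c := Finsupp.single_le_iff.2 hcj.ge
      have h2 : (c - e).degree = 0 := by
        have := congrArg Finsupp.degree (tsub_add_cancel_of_le h1)
        rw [map_add, Finsupp.degree_single, hdeg] at this
        simpa [he] using this
      rw [Finsupp.degree_eq_zero_iff] at h2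
      exact le_antisymm (tsub_eq_zero_iff_le.1 h2) h1
    -- The variables before `j` are untouched and the exponent of `X_j` drops.
    have hlt : toLex (a - e + c) < toLex a := by
      rw [Finsupp.Lex.lt_iff]
      refine ⟨j, fun l hl => ?_, ?_⟩
      · simp [he, hpl c hcs l hl, Finsupp.single_eq_of_ne hl.ne]
      · simp only [ofLex_toLex, he, Finsupp.add_apply, Finsupp.tsub_apply, Finsupp.single_eq_same]
        omega
    have := ih _ hlt
    have hd : (a - e + c).degree = a.degree := by
      have := congrArg Finsupp.degree (tsub_add_cancel_of_le hle)
      rw [map_add, he, Finsupp.degree_single] at this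
      rw [map_add, hdeg, ← this]
    rwa [hd] at this
  have : coeff e p • monomial a (1 : F) ∈ V := by
    have := Submodule.sub_mem _ hmem hrest
    rwa [hexp, add_sub_cancel_right] at this
  exact (Submodule.smul_mem_iff _ hpc).1 this

end Reduction

lemma sum_fin_val (n : ℕ) : ∑ j : Fin n, (j : ℕ) = n.choose 2 := by
  rw [Fin.sum_univ_eq_sum_range (fun i => i), Finset.sum_range_id, Nat.choose_two_right]

section Relations

variable {F : Type*} [Field F] {n : ℕ}

/-- An ideal containing the elementary symmetric polynomials of positive degree and, for every
nonempty `J ⊆ K` and `i ∈ J`, the product `∏_{l ∉ J} (X_i - X_l)`. The annihilator of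
`dx_K` modulo the invariant ideal is of this kind. -/
structure HasRelations (K : Finset (Fin n)) (A : Ideal (MvPolynomial (Fin n) F)) : Prop where
  coeff_mem : ∀ m, 0 < m → PowerSeries.coeff m (elemSeries X Finset.univ) ∈ A
  prod_mem : ∀ J ⊆ K, ∀ i ∈ J, ∏ l ∈ Jᶜ, (X i - X l) ∈ A

namespace HasRelations

variable {K : Finset (Fin n)} {A : Ideal (MvPolynomial (Fin n) F)}

lemma elemSeries_eq_one (hA : HasRelations K A) :
    elemSeries (fun i => Ideal.Quotient.mk A (X i)) Finset.univ = 1 := by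
  rw [← map_elemSeries]
  ext m
  rw [PowerSeries.coeff_map, PowerSeries.coeff_one]
  split_ifs with h
  · rw [h, coeff_zero_elemSeries, map_one]
  · exact Ideal.Quotient.eq_zero_iff_mem.2 (hA.coeff_mem m (Nat.pos_of_ne_zero h))

lemma completeHomog_mem (hA : HasRelations K A) {s : Finset (Fin n)} {m : ℕ} (hm : sᶜ.card < m) :
    completeHomog X s m ∈ A := by
  rw [← Ideal.Quotient.eq_zero_iff_mem, map_completeHomog]
  exact completeHomog_eq_zero hA.elemSeries_eq_one hm

lemma sum_completeHomog_eq_zero (hA : HasRelations K A) {J : Finset (Fin n)} (hJ : J ⊆ K)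
    {i : Fin n} (hi : i ∈ J) :
    ∑ m ∈ Finset.range (Jᶜ.card + 1), completeHomog (fun i => Ideal.Quotient.mk A (X i)) J m *
      Ideal.Quotient.mk A (X i) ^ (Jᶜ.card - m) = 0 := by
  rw [← prod_compl_sub hA.elemSeries_eq_one, ← Ideal.Quotient.eq_zero_iff_mem.2
    (hA.prod_mem J hJ i hi)]
  simp [map_prod]

lemma sum_completeHomog_mem (hA : HasRelations K A) {J : Finset (Fin n)} (hJ : J ⊆ K)
    {i : Fin n} (hi : i ∈ J) :
    ∑ m ∈ Finset.range (Jᶜ.card + 1), completeHomog X J m * X i ^ (Jᶜ.card - m) ∈ A := by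
  rw [← Ideal.Quotient.eq_zero_iff_mem, map_sum, ← hA.sum_completeHomog_eq_zero hJ hi]
  simp [map_completeHomog]

variable [CharZero F]

/-- For `K` an upper set, the relations reduce every monomial to those with exponents
`a j ≤ j`, and `a j < j` for `j ∈ K`. -/
lemma exists_leading (hA : HasRelations K A) (hK : IsUpperSet (K : Set (Fin n))) (j : Fin n) :
    ∃ p ∈ A, p.IsHomogeneous (if j ∈ K then (j : ℕ) else j + 1) ∧
      (∀ c ∈ p.support, ∀ l < j, c l = 0) ∧
      coeff (Finsupp.single j (if j ∈ K then (j : ℕ) else j + 1)) p ≠ 0 := by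
  have hcard : ((Finset.Ici j)ᶜ).card = j := by
    rw [Finset.card_compl, Fin.card_Ici, Fintype.card_fin]
    omega
  have hsupp : ∀ p ∈ supported F ((Finset.Ici j : Finset (Fin n)) : Set (Fin n)),
      ∀ c ∈ p.support, ∀ l < j, c l = 0 := by
    intro p hp c hc l hl
    by_contra hcl
    have : l ∈ p.vars := (mem_vars_iff_mem_support l).2 ⟨c, hc, Finsupp.mem_support_iff.2 hcl⟩
    have := mem_supported.1 hp this
    simp only [Finset.coe_Ici, Set.mem_Ici] at this
    exact absurd this (not_le.2 hl)
  have hj : j ∈ Finset.Ici j := Finset.mem_Ici.2 le_rfl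
  split_ifs with h
  · have hsub : Finset.Ici j ⊆ K := fun l hl => hK (Finset.mem_Ici.1 hl) h
    refine ⟨_, hA.sum_completeHomog_mem hsub hj, ?_, hsupp _ ?_, ?_⟩
    · rw [hcard]
      refine IsHomogeneous.sum _ _ _ fun m hm => ?_
      have := (isHomogeneous_completeHomog (F := F) (Finset.Ici j) m).mul
        ((isHomogeneous_X F j).pow ((j : ℕ) - m))
      rwa [one_mul, Nat.add_sub_cancel' (Nat.lt_succ_iff.1 (Finset.mem_range.1 hm))] at this
    · exact sum_mem fun m _ => mul_mem (completeHomog_mem_supported _ _)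
        (pow_mem (X_mem_supported.2 (by simp)) _)
    -- Each of the `j + 1` summands contributes `1` to the leading coefficient.
    · rw [hcard, coeff_sum, Finset.sum_congr rfl (g := fun _ => (1 : F))]
      · simpa using Nat.cast_add_one_ne_zero (R := F) (j : ℕ)
      · intro m hm
        have hm' : m ≤ j := Nat.lt_succ_iff.1 (Finset.mem_range.1 hm)
        have e : Finsupp.single j (j : ℕ) = Finsupp.single j m + Finsupp.single j ((j : ℕ) - m) := by
          rw [← Finsupp.single_add, Nat.add_sub_cancel' hm']
        rw [X_pow_eq_monomial, e, coeff_mul_monomial, mul_one, coeff_single_completeHomog hj]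
  · refine ⟨_, hA.completeHomog_mem (s := Finset.Ici j) (m := j + 1) (by omega),
      isHomogeneous_completeHomog _ _, hsupp _ (completeHomog_mem_supported _ _), ?_⟩
    rw [coeff_single_completeHomog hj]
    exact one_ne_zero

lemma eq_zero_of_natCast_mul {k : ℕ} (hk : k ≠ 0) {q : MvPolynomial (Fin n) F ⧸ A}
    (h : (k : MvPolynomial (Fin n) F ⧸ A) * q = 0) : q = 0 := by
  have : (k : F) • q = 0 := by
    rw [Nat.cast_smul_eq_nsmul, nsmul_eq_mul, h]
  exact (smul_eq_zero_iff_right (Nat.cast_ne_zero.2 hk)).1 this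

/-- The relation for `J = {i}` is `n X_i ^ (n - 1) = 0`. -/
lemma mk_X_pow_eq_zero (hA : HasRelations K A) {i : Fin n} (hi : i ∈ K) :
    Ideal.Quotient.mk A (X i) ^ (n - 1) = 0 := by
  have h := hA.sum_completeHomog_eq_zero (Finset.singleton_subset_iff.2 hi)
    (Finset.mem_singleton_self i)
  simp_rw [completeHomog_singleton] at h
  rw [Finset.card_compl, Fintype.card_fin, Finset.card_singleton, Finset.sum_congr rfl
    (g := fun _ => Ideal.Quotient.mk A (X i) ^ (n - 1))] at h
  · rw [Finset.sum_const, Finset.card_range, nsmul_eq_mul] at h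
    exact eq_zero_of_natCast_mul (Nat.succ_ne_zero _) h
  · intro m hm
    rw [← pow_add, Nat.add_sub_cancel' (Nat.lt_succ_iff.1 (Finset.mem_range.1 hm))]

/-- The monomial that would be left over in top degree vanishes as soon as `K` has two elements. -/
lemma mk_X_pow_mul_eq_zero (hA : HasRelations K A) {N : ℕ} (hn : n = N + 3) {i j : Fin n}
    (hij : i ≠ j) (hi : i ∈ K) (hj : j ∈ K) :
    Ideal.Quotient.mk A (X i) ^ (N + 1) * Ideal.Quotient.mk A (X j) ^ N = 0 := by
  have key : ∀ i j : Fin n, i ≠ j → i ∈ K → j ∈ K →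
      ((N : MvPolynomial (Fin n) F ⧸ A) + 2) *
        (Ideal.Quotient.mk A (X i) ^ (N + 1) * Ideal.Quotient.mk A (X j) ^ N) +
      ((N : MvPolynomial (Fin n) F ⧸ A) + 1) *
        (Ideal.Quotient.mk A (X i) ^ N * Ideal.Quotient.mk A (X j) ^ (N + 1)) = 0 := by
    intro i j hij hi hj
    have hJ : ({j, i} : Finset (Fin n)) ⊆ K := by
      intro l hl
      rcases Finset.mem_insert.1 hl with rfl | hl
      · exact hj
      · rwa [Finset.mem_singleton.1 hl]
    have hc : (({j, i} : Finset (Fin n))ᶜ).card = N + 1 := by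
      rw [Finset.card_compl, Finset.card_pair hij.symm, Fintype.card_fin]
      omega
    have hs := hA.sum_completeHomog_eq_zero hJ (i := i) (by simp)
    rw [hc] at hs
    refine pair_relation _ _ N (completeHomog _ {j, i}) (completeHomog_zero _ _) (fun m => ?_) ?_ hs
    · rw [completeHomog_insert _ (by simpa using hij.symm), completeHomog_singleton]
    · have := hA.mk_X_pow_eq_zero hj
      rwa [show n - 1 = N + 2 by omega] at this
  have h₁ := key i j hij hi hj
  have h₂ := key j i hij.symm hj hi
  -- The determinant of the two relations is `(N + 2)² - (N + 1)² = 2 N + 3`.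
  refine eq_zero_of_natCast_mul (k := 2 * N + 3) (by omega) ?_
  push_cast
  linear_combination ((N : MvPolynomial (Fin n) F ⧸ A) + 2) * h₁ -
    ((N : MvPolynomial (Fin n) F ⧸ A) + 1) * h₂

lemma exists_top_of_isUpperSet (hA : HasRelations K A) (hK : IsUpperSet (K : Set (Fin n))) :
    ∃ t : Fin n →₀ ℕ, ∀ a : Fin n →₀ ℕ, n.choose 2 ≤ a.degree + K.card →
      (∃ c : F, monomial a 1 - c • monomial t 1 ∈ A) ∧
      ((n.choose 2 < a.degree + K.card ∨ 2 ≤ K.card) → monomial a 1 ∈ A) := by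
  classical
  let t : Fin n →₀ ℕ := Finsupp.equivFunOnFinite.symm fun j => if j ∈ K then (j : ℕ) - 1 else j
  have ht : ∀ j, t j = if j ∈ K then (j : ℕ) - 1 else j := fun j => rfl
  have hsum : ∀ c : Fin n →₀ ℕ, c.degree + K.card = ∑ j, (c j + if j ∈ K then 1 else 0) := by
    intro c
    rw [Finset.sum_add_distrib, Finsupp.degree_eq_sum]
    simp
  -- Reduced exponents satisfy `c j + [j ∈ K] ≤ j`; the sum over `j` is the degree bound, with
  -- equality only for `t`. For `0 ∈ K` there are no reduced exponents, and `t 0 = 0` is harmless.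
  have hle : ∀ c : Fin n →₀ ℕ, (∀ j, c j < if j ∈ K then (j : ℕ) else j + 1) →
      c.degree + K.card ≤ n.choose 2 ∧ (c.degree + K.card = n.choose 2 → c = t) := by
    intro c hc
    have hterm : ∀ j ∈ Finset.univ, (c j + if j ∈ K then 1 else 0) ≤ (j : ℕ) := by
      intro j _
      have := hc j
      split_ifs at this ⊢ <;> omega
    rw [hsum, ← sum_fin_val]
    refine ⟨Finset.sum_le_sum hterm, fun h => ?_⟩
    ext j
    have := (Finset.sum_eq_sum_iff_of_le hterm).1 h j (Finset.mem_univ j)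
    rw [ht]
    split_ifs at this ⊢ <;> omega
  have hred := monomial_mem_sup_span A _ (hA.exists_leading hK)
  have hgt : ∀ a : Fin n →₀ ℕ, n.choose 2 < a.degree + K.card → monomial a (1 : F) ∈ A := by
    intro a ha
    have h := hred a
    rw [Set.eq_empty_of_forall_notMem (s := {c : Fin n →₀ ℕ | c.degree = a.degree ∧ _})] at h
    · simpa using h
    · rintro c ⟨hca, hc⟩
      have := (hle c hc).1
      omega
  have htop : ∀ a : Fin n →₀ ℕ, n.choose 2 = a.degree + K.card →
      ∃ c : F, monomial a 1 - c • monomial t 1 ∈ A := by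
    intro a ha
    have hsub : (fun c => monomial c (1 : F)) '' {c : Fin n →₀ ℕ | c.degree = a.degree ∧
        ∀ j, c j < if j ∈ K then (j : ℕ) else j + 1} ⊆ {monomial t 1} := by
      rintro _ ⟨c, ⟨hca, hc⟩, rfl⟩
      rw [(hle c hc).2 (by omega)]
      rfl
    obtain ⟨y, hy, z, hz, hyz⟩ := Submodule.mem_sup.1
      (sup_le_sup_left (Submodule.span_mono hsub) (A.restrictScalars F) (hred a))
    obtain ⟨c, rfl⟩ := Submodule.mem_span_singleton.1 hz
    exact ⟨c, by rw [← hyz, add_sub_cancel_right]; exact hy⟩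
  have htA : 2 ≤ K.card → monomial t (1 : F) ∈ A := by
    intro hK2
    have hn : 2 ≤ n := hK2.trans (card_finset_fin_le K)
    obtain ⟨N, rfl⟩ : ∃ N, n = N + 2 := ⟨n - 2, by omega⟩
    have hj : (⟨N, by omega⟩ : Fin (N + 2)) ∈ K := by
      by_contra hj
      have hsub : K ⊆ {Fin.last (N + 1)} := by
        intro l hl
        by_contra hl'
        rw [Finset.mem_singleton, Fin.ext_iff, Fin.val_last] at hl'
        exact hj (hK (Fin.le_def.2 (by simp only; omega)) hl)
      have := Finset.card_le_card hsub
      rw [Finset.card_singleton] at this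
      omega
    have hi : Fin.last (N + 1) ∈ K := hK (Fin.le_last _) hj
    cases N with
    | zero =>
      -- For `n = 2` the empty product `∏_{l ∉ K}` shows that the ideal is everything.
      have hK' : K = Finset.univ := by
        refine Finset.eq_univ_of_card K (le_antisymm (card_finset_fin_le K) ?_ |>.trans
          (Fintype.card_fin _).symm)
        exact hK2
      have h1 := hA.prod_mem K subset_rfl _ hi
      rw [hK', Finset.compl_univ, Finset.prod_empty] at h1
      rw [(Ideal.eq_top_iff_one A).2 h1]
      trivial
    | succ N =>
      have hij : Fin.last (N + 2) ≠ ⟨N + 1, by omega⟩ := by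
        rw [Ne, Fin.ext_iff, Fin.val_last]
        simp
      have h0 := hA.mk_X_pow_mul_eq_zero rfl hij hi hj
      rw [← map_pow, ← map_pow, ← map_mul, Ideal.Quotient.eq_zero_iff_mem, X_pow_eq_monomial,
        X_pow_eq_monomial, monomial_mul, one_mul] at h0
      refine A.mem_of_dvd (monomial_one_dvd_monomial_one.2 fun l => ?_) h0
      rw [Finsupp.add_apply, ht]
      by_cases h1 : Fin.last (N + 2) = l
      · subst h1
        rw [Finsupp.single_eq_same, Finsupp.single_eq_of_ne hij, if_pos hi]
        simp
      · rw [Finsupp.single_eq_of_ne (Ne.symm h1), zero_add]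
        by_cases h2 : (⟨N + 1, by omega⟩ : Fin (N + 3)) = l
        · subst h2
          rw [Finsupp.single_eq_same, if_pos hj]
          simp
        · rw [Finsupp.single_eq_of_ne (Ne.symm h2)]
          exact Nat.zero_le _
  refine ⟨t, fun a ha => ?_⟩
  rcases ha.lt_or_eq with hlt | heq
  · exact ⟨⟨0, by simpa using hgt a hlt⟩, fun _ => hgt a hlt⟩
  · refine ⟨htop a heq, fun h => ?_⟩
    rcases h with h | h
    · exact hgt a h
    · obtain ⟨c, hc⟩ := htop a heq
      have := A.add_mem hc (Submodule.smul_of_tower_mem A c (htA h))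
      rwa [sub_add_cancel] at this

omit [CharZero F] in
lemma comap_rename (hA : HasRelations K A) (ρ : Equiv.Perm (Fin n)) {U : Finset (Fin n)}
    (hU : U.map ρ.toEmbedding = K) : HasRelations U (A.comap (rename (R := F) ρ)) where
  coeff_mem m hm := by
    rw [Ideal.mem_comap]
    rw [rename_coeff_elemSeries]
    exact hA.coeff_mem m hm
  prod_mem J hJ i hi := by
    rw [Ideal.mem_comap]
    have := hA.prod_mem (J.map ρ.toEmbedding) (hU ▸ Finset.map_subset_map.2 hJ) (ρ i)
      (Finset.mem_map_of_mem _ hi)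
    have hc : (J.map ρ.toEmbedding)ᶜ = Jᶜ.map ρ.toEmbedding := by
      ext l
      simp [Finset.mem_map_equiv]
    rw [hc, Finset.prod_map] at this
    rw [map_prod]
    simp only [map_sub, rename_X]
    exact this

/-- The annihilator of `dx_K` contains all polynomials of degree more than `C(n,2) - |K|`, has
codimension at most one in degree `C(n,2) - |K|`, and contains that degree if `|K| ≥ 2`. -/
theorem exists_top (hA : HasRelations K A) :
    ∃ t : Fin n →₀ ℕ, ∀ a : Fin n →₀ ℕ, n.choose 2 ≤ a.degree + K.card →
      (∃ c : F, monomial a 1 - c • monomial t 1 ∈ A) ∧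
      ((n.choose 2 < a.degree + K.card ∨ 2 ≤ K.card) → monomial a 1 ∈ A) := by
  classical
  obtain ⟨U, hUc, hU⟩ : ∃ U : Finset (Fin n), U.card = K.card ∧ IsUpperSet (U : Set (Fin n)) := by
    have hKn := card_finset_fin_le K
    rcases Nat.eq_zero_or_pos K.card with h | h
    · exact ⟨∅, by simp [h], by simp [isUpperSet_empty]⟩
    · refine ⟨Finset.Ici ⟨n - K.card, by omega⟩, ?_, by
        rw [Finset.coe_Ici]; exact isUpperSet_Ici _⟩
      rw [Fin.card_Ici]
      simp only
      omega
  obtain ⟨ρ, hρ⟩ : ∃ ρ : Equiv.Perm (Fin n), U.map ρ.toEmbedding = K := by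
    refine ⟨(Finset.equivOfCardEq hUc).extendSubtype, ?_⟩
    refine Finset.eq_of_subset_of_card_le (fun l hl => ?_) (by rw [Finset.card_map, hUc])
    obtain ⟨i, hi, rfl⟩ := Finset.mem_map.1 hl
    exact (Finset.equivOfCardEq hUc).extendSubtype_mem i hi
  obtain ⟨t, ht⟩ := (hA.comap_rename ρ hρ).exists_top_of_isUpperSet hU
  refine ⟨t.mapDomain ρ, fun a ha => ?_⟩
  have hdeg : (a.mapDomain ρ.symm).degree = a.degree := by
    rw [Finsupp.degree_mapDomain]
  have hback : (a.mapDomain ρ.symm).mapDomain ρ = a := by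
    rw [← Finsupp.mapDomain_comp]
    simp
  have := ht (a.mapDomain ρ.symm)
  rw [hdeg, hUc] at this
  simpa only [Ideal.mem_comap, map_sub, map_smul, rename_monomial, hback] using this ha

end HasRelations
end Relations

/-! ### Monomial forms and the invariant ideal -/

variable {𝕜 : Type*} [RCLike 𝕜] {n : ℕ}

/-- The basis vector `dx_{i₁} ∧ ⋯ ∧ dx_{i_k}` of the exterior algebra, `K = {i₁ < ⋯ < i_k}`. -/
def wedge (𝕜 : Type*) [RCLike 𝕜] {n : ℕ} (K : Finset (Fin n)) :
    ExteriorAlgebra 𝕜 (Fin n → 𝕜) :=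
  (Pi.basisFun 𝕜 (Fin n)).ExteriorAlgebra K

lemma wedge_mul_of_disjoint {s t : Finset (Fin n)} (h : Disjoint s t) :
    ∃ u : ℤˣ, wedge 𝕜 s * wedge 𝕜 t = u • wedge 𝕜 (s ∪ t) := by
  let s' : Set.powersetCard (Fin n) s.card := ⟨s, rfl⟩
  let t' : Set.powersetCard (Fin n) t.card := ⟨t, rfl⟩
  have h' : Disjoint s'.val t'.val := h
  refine ⟨(Set.powersetCard.permOfDisjoint h').sign, ?_⟩
  rw [← Finset.disjUnion_eq_union s t h]
  exact ExteriorAlgebra.basis_mul_of_disjoint (Pi.basisFun 𝕜 (Fin n)) s' t' h'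

lemma wedge_mul_of_not_disjoint {s t : Finset (Fin n)} (h : ¬ Disjoint s t) :
    wedge 𝕜 s * wedge 𝕜 t = 0 :=
  ExteriorAlgebra.basis_mul_of_not_disjoint (Pi.basisFun 𝕜 (Fin n))
    (⟨s, rfl⟩ : Set.powersetCard (Fin n) s.card) (⟨t, rfl⟩ : Set.powersetCard (Fin n) t.card) h

lemma wedge_empty : wedge 𝕜 (∅ : Finset (Fin n)) = 1 := by
  rw [wedge, ExteriorAlgebra.basis_apply_ofCard _ (Finset.card_empty)]
  simp [ExteriorAlgebra.ιMulti_family]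

lemma wedge_singleton (i : Fin n) :
    wedge 𝕜 {i} = ExteriorAlgebra.ι 𝕜 (Pi.single i (1 : 𝕜)) := by
  rw [wedge, ExteriorAlgebra.basis_apply_ofCard _ (Finset.card_singleton i)]
  simp [ExteriorAlgebra.ιMulti_family, ExteriorAlgebra.ιMulti_apply,
    Set.powersetCard.ofFinEmbEquiv_symm_apply, Set.powersetCard.ofCard]

lemma monomialBasis_apply (b : (Fin n →₀ ℕ) × Finset (Fin n)) :
    monomialBasis 𝕜 n b = monomial b.1 (1 : 𝕜) ⊗ₜ[𝕜] wedge 𝕜 b.2 := by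
  rw [monomialBasis, Module.Basis.tensorProduct_apply']
  simp [wedge]

lemma monomialBasis_repr_tmul_wedge (f : MvPolynomial (Fin n) 𝕜) (K : Finset (Fin n))
    (b : (Fin n →₀ ℕ) × Finset (Fin n)) :
    (monomialBasis 𝕜 n).repr (f ⊗ₜ[𝕜] wedge 𝕜 K) b = if K = b.2 then coeff b.1 f else 0 := by
  rw [monomialBasis, wedge]
  rw [show b = (b.1, b.2) from rfl, Module.Basis.tensorProduct_repr_tmul_apply]
  simp [Finsupp.single_apply, MvPolynomial.basisMonomials, MvPolynomial.coeff]

lemma tmul_wedge_mem_homogeneous {f : MvPolynomial (Fin n) 𝕜} {d : ℕ} (hf : f.IsHomogeneous d)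
    (K : Finset (Fin n)) : f ⊗ₜ[𝕜] wedge 𝕜 K ∈ homogeneous 𝕜 n (d + K.card) := by
  rw [f.as_sum, TensorProduct.sum_tmul]
  refine Submodule.sum_mem _ fun a ha => ?_
  have : monomial a (coeff a f) ⊗ₜ[𝕜] wedge 𝕜 K = coeff a f • monomialBasis 𝕜 n (a, K) := by
    rw [monomialBasis_apply, TensorProduct.smul_tmul', smul_monomial, smul_eq_mul, mul_one]
  rw [this]
  refine Submodule.smul_mem _ _ (Submodule.subset_span ⟨_, ?_, rfl⟩)
  have hd : a.degree = d := by
    rw [Finsupp.degree_eq_weight_one]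
    exact hf (mem_support_iff.1 ha)
  exact congrArg (· + K.card) hd

lemma isHomogeneous_coeff_elemSeries {F ι : Type*} [Field F] (s : Finset ι) (m : ℕ) :
    (PowerSeries.coeff m (elemSeries (X : ι → MvPolynomial ι F) s)).IsHomogeneous m := by
  classical
  induction s using Finset.induction_on generalizing m with
  | empty =>
    rw [elemSeries, Finset.prod_empty, PowerSeries.coeff_one]
    split_ifs with h
    · exact h ▸ isHomogeneous_one _ _
    · exact isHomogeneous_zero _ _ _
  | insert a s ha ih =>
    cases m with
    | zero => 
      rw [coeff_zero_elemSeries]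
      exact isHomogeneous_one _ _
    | succ m =>
      rw [coeff_elemSeries_insert _ ha]
      refine (ih _).sub ?_
      have := (isHomogeneous_X F a).mul (ih m)
      rwa [add_comm] at this

lemma permAct_tmul_one (σ : Equiv.Perm (Fin n)) (f : MvPolynomial (Fin n) 𝕜) :
    permAct 𝕜 σ (f ⊗ₜ[𝕜] 1) = rename σ f ⊗ₜ[𝕜] 1 := by
  simp [permAct]

lemma permAct_tmul_ι (σ : Equiv.Perm (Fin n)) (f : MvPolynomial (Fin n) 𝕜) (i : Fin n) :
    permAct 𝕜 σ (f ⊗ₜ[𝕜] ExteriorAlgebra.ι 𝕜 (Pi.single i (1 : 𝕜))) =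
      rename σ f ⊗ₜ[𝕜] ExteriorAlgebra.ι 𝕜 (Pi.single (σ i) (1 : 𝕜)) := by
  have : LinearMap.funLeft 𝕜 𝕜 σ.symm (Pi.single i (1 : 𝕜)) = Pi.single (σ i) (1 : 𝕜) := by
    ext j
    simp [LinearMap.funLeft_apply, Pi.single_apply, Equiv.symm_apply_eq]
  simp [permAct, this]

lemma coeff_elemSeries_tmul_one_mem {m : ℕ} (hm : 0 < m) :
    PowerSeries.coeff m (elemSeries (X : Fin n → MvPolynomial (Fin n) 𝕜) Finset.univ) ⊗ₜ[𝕜] 1 ∈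
      invariantIdeal 𝕜 n := by
  refine TwoSidedIdeal.subset_span ⟨fun σ => ?_, m, hm, ?_⟩
  · rw [permAct_tmul_one, rename_coeff_elemSeries]
  · have := tmul_wedge_mem_homogeneous (𝕜 := 𝕜)
      (isHomogeneous_coeff_elemSeries (F := 𝕜) (Finset.univ : Finset (Fin n)) m) ∅
    rwa [wedge_empty] at this

lemma sum_X_pow_tmul_mem (m : ℕ) :
    ∑ i : Fin n, (X i ^ m : MvPolynomial (Fin n) 𝕜) ⊗ₜ[𝕜]
      ExteriorAlgebra.ι 𝕜 (Pi.single i (1 : 𝕜)) ∈ invariantIdeal 𝕜 n := by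
  refine TwoSidedIdeal.subset_span ⟨fun σ => ?_, m + 1, Nat.succ_pos m, ?_⟩
  · rw [map_sum]
    simp only [permAct_tmul_ι, map_pow, rename_X]
    exact Equiv.sum_comp σ fun i => (X i ^ m : MvPolynomial (Fin n) 𝕜) ⊗ₜ[𝕜]
      ExteriorAlgebra.ι 𝕜 (Pi.single i (1 : 𝕜))
  · refine Submodule.sum_mem _ fun i _ => ?_
    have h : (X i ^ m : MvPolynomial (Fin n) 𝕜).IsHomogeneous m := by
      simpa using (isHomogeneous_X 𝕜 i).pow m
    have := tmul_wedge_mem_homogeneous (𝕜 := 𝕜) h {i}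
    rwa [wedge_singleton] at this

/-- The polynomials `f` for which `f dx_K` lies in the invariant ideal. -/
def annihilator (𝕜 : Type*) [RCLike 𝕜] {n : ℕ} (K : Finset (Fin n)) :
    Ideal (MvPolynomial (Fin n) 𝕜) where
  carrier := {f | f ⊗ₜ[𝕜] wedge 𝕜 K ∈ invariantIdeal 𝕜 n}
  add_mem' {f g} hf hg := by
    rw [Set.mem_ofPred_eq, TensorProduct.add_tmul]
    exact TwoSidedIdeal.add_mem _ hf hg
  zero_mem' := by
    rw [Set.mem_ofPred_eq, TensorProduct.zero_tmul]
    exact TwoSidedIdeal.zero_mem _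
  smul_mem' c f hf := by
    have := (invariantIdeal 𝕜 n).mul_mem_left (c ⊗ₜ 1) _ hf
    rwa [Algebra.TensorProduct.tmul_mul_tmul, one_mul] at this

lemma mem_annihilator {K : Finset (Fin n)} {f : MvPolynomial (Fin n) 𝕜} :
    f ∈ annihilator 𝕜 K ↔ f ⊗ₜ[𝕜] wedge 𝕜 K ∈ invariantIdeal 𝕜 n := Iff.rfl

/-- The second kind of relation comes from `∑ j, g(x_j) dx_j`, `g(t) = ∏_{l ∉ J} (t - x_l)`,
multiplied by `dx_{K ∖ i}`: the terms with `j ∉ J` vanish because `g(x_j) = 0`, those with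
`j ∈ J ∖ i` because `dx_j ∧ dx_j = 0`. -/
lemma hasRelations_annihilator (K : Finset (Fin n)) : HasRelations K (annihilator 𝕜 K) where
  coeff_mem m hm := by
    have := (invariantIdeal 𝕜 n).mul_mem_right _ (1 ⊗ₜ wedge 𝕜 K)
      (coeff_elemSeries_tmul_one_mem (𝕜 := 𝕜) (n := n) hm)
    rwa [Algebra.TensorProduct.tmul_mul_tmul, one_mul, mul_one] at this
  prod_mem J hJ i hi := by
    set g : Fin n → MvPolynomial (Fin n) 𝕜 := fun j => ∏ l ∈ Jᶜ, (X j - X l) with hg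
    have h₁ : ∑ j, g j ⊗ₜ[𝕜] ExteriorAlgebra.ι 𝕜 (Pi.single j (1 : 𝕜)) ∈ invariantIdeal 𝕜 n := by
      have : ∑ j, g j ⊗ₜ[𝕜] ExteriorAlgebra.ι 𝕜 (Pi.single j (1 : 𝕜)) =
          ∑ m ∈ Finset.range (Jᶜ.card + 1), PowerSeries.coeff m (elemSeries X Jᶜ) ⊗ₜ[𝕜] 1 *
            ∑ j, (X j ^ (Jᶜ.card - m) : MvPolynomial (Fin n) 𝕜) ⊗ₜ[𝕜]
              ExteriorAlgebra.ι 𝕜 (Pi.single j (1 : 𝕜)) := by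
        simp_rw [Finset.mul_sum, Algebra.TensorProduct.tmul_mul_tmul, one_mul]
        rw [Finset.sum_comm]
        refine Finset.sum_congr rfl fun j _ => ?_
        rw [hg, ← TensorProduct.sum_tmul]
        simp only [prod_sub_eq_sum_coeff]
      rw [this]
      exact TwoSidedIdeal.finsetSum_mem _ _ _ fun m _ =>
        TwoSidedIdeal.mul_mem_left _ _ _ (sum_X_pow_tmul_mem _)
    have h₂ := (invariantIdeal 𝕜 n).mul_mem_right _ (1 ⊗ₜ wedge 𝕜 (K.erase i)) h₁
    rw [Finset.sum_mul, Finset.sum_eq_single_of_mem i (Finset.mem_univ i)] at h₂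
    · rw [← wedge_singleton, Algebra.TensorProduct.tmul_mul_tmul, mul_one] at h₂
      obtain ⟨u, hu⟩ := wedge_mul_of_disjoint (𝕜 := 𝕜) (s := {i}) (t := K.erase i) (by simp)
      have hK : {i} ∪ K.erase i = K := by
        rw [← Finset.insert_eq, Finset.insert_erase (hJ hi)]
      rw [hu, hK] at h₂
      rcases Int.units_eq_one_or u with rfl | rfl
      · rw [one_smul] at h₂
        exact h₂
      · rw [Units.neg_smul, one_smul, TensorProduct.tmul_neg] at h₂
        have := TwoSidedIdeal.neg_mem _ h₂
        rw [neg_neg] at this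
        exact this
    · intro j _ hji
      rw [← wedge_singleton, Algebra.TensorProduct.tmul_mul_tmul, mul_one]
      by_cases hj : j ∈ J
      · rw [wedge_mul_of_not_disjoint, TensorProduct.tmul_zero]
        simpa using ⟨hji, hJ hj⟩
      · have : g j = 0 := Finset.prod_eq_zero (Finset.mem_compl.2 hj) (sub_self _)
        rw [this, TensorProduct.zero_tmul]

/-! ### Dual numbers -/

/-- The linear map `dxᵢ ↦ xᵢ ε` to the dual numbers over the polynomials. -/
def dualDifferential (𝕜 : Type*) [RCLike 𝕜] (n : ℕ) :
    (Fin n → 𝕜) →ₗ[𝕜] DualNumber (MvPolynomial (Fin n) 𝕜) :=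
  (TrivSqZeroExt.inrHom (MvPolynomial (Fin n) 𝕜) (MvPolynomial (Fin n) 𝕜)).restrictScalars 𝕜 ∘ₗ
    Fintype.linearCombination 𝕜 X

lemma dualDifferential_apply (v : Fin n → 𝕜) :
    dualDifferential 𝕜 n v = TrivSqZeroExt.inr (Fintype.linearCombination 𝕜 X v) := rfl

/-- The algebra homomorphism `xᵢ ↦ xᵢ`, `dxᵢ ↦ xᵢ ε` to the dual numbers over the polynomials. Its
`ε`-part `∑ fᵢ dxᵢ ↦ ∑ fᵢ xᵢ` is adjoint to the exterior derivative on polynomials. -/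
def toDual (𝕜 : Type*) [RCLike 𝕜] (n : ℕ) :
    Form 𝕜 n →ₐ[𝕜] DualNumber (MvPolynomial (Fin n) 𝕜) :=
  Algebra.TensorProduct.lift (TrivSqZeroExt.inlAlgHom 𝕜 _ _)
    (ExteriorAlgebra.lift 𝕜 ⟨dualDifferential 𝕜 n, fun v => by
      rw [dualDifferential_apply, TrivSqZeroExt.inr_mul_inr]⟩)
    fun _ _ => Commute.all _ _

lemma toDual_tmul_one (f : MvPolynomial (Fin n) 𝕜) :
    toDual 𝕜 n (f ⊗ₜ[𝕜] 1) = TrivSqZeroExt.inl f := by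
  simp [toDual]

lemma toDual_tmul_ι (f : MvPolynomial (Fin n) 𝕜) (i : Fin n) :
    toDual 𝕜 n (f ⊗ₜ[𝕜] ExteriorAlgebra.ι 𝕜 (Pi.single i (1 : 𝕜))) =
      TrivSqZeroExt.inr (f * X i) := by
  rw [toDual, Algebra.TensorProduct.lift_tmul, ExteriorAlgebra.lift_ι_apply,
    dualDifferential_apply, Fintype.linearCombination_apply_single, one_smul]
  exact TrivSqZeroExt.inl_mul_inr f (X i)

lemma toDual_tmul_wedge (f : MvPolynomial (Fin n) 𝕜) {K : Finset (Fin n)} (hK : 2 ≤ K.card) :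
    toDual 𝕜 n (f ⊗ₜ[𝕜] wedge 𝕜 K) = 0 := by
  obtain ⟨i, hi⟩ : K.Nonempty := Finset.card_pos.1 (by omega)
  obtain ⟨j, hj⟩ : (K.erase i).Nonempty := Finset.card_pos.1 (by
    rw [Finset.card_erase_of_mem hi]; omega)
  have hsplit : ∀ (S : Finset (Fin n)) (i : Fin n), i ∈ S →
      ∃ u : ℤˣ, wedge 𝕜 S = u • (wedge 𝕜 {i} * wedge 𝕜 (S.erase i)) := by
    intro S i hi
    obtain ⟨u, hu⟩ := wedge_mul_of_disjoint (𝕜 := 𝕜) (s := {i}) (t := S.erase i) (by simp)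
    rw [← Finset.insert_eq, Finset.insert_erase hi] at hu
    exact ⟨u⁻¹, by rw [hu, inv_smul_smul]⟩
  obtain ⟨u, hu⟩ := hsplit K i hi
  obtain ⟨v, hv⟩ := hsplit _ j hj
  have h0 : toDual 𝕜 n (f ⊗ₜ[𝕜] (wedge 𝕜 {i} * (wedge 𝕜 {j} * wedge 𝕜 ((K.erase i).erase j)))) =
      0 := by
    have : f ⊗ₜ[𝕜] (wedge 𝕜 {i} * (wedge 𝕜 {j} * wedge 𝕜 ((K.erase i).erase j))) =
        (f ⊗ₜ[𝕜] wedge 𝕜 {i}) * ((1 ⊗ₜ[𝕜] wedge 𝕜 {j}) *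
          (1 ⊗ₜ[𝕜] wedge 𝕜 ((K.erase i).erase j))) := by
      simp only [Algebra.TensorProduct.tmul_mul_tmul, mul_one]
    rw [this, map_mul, map_mul, ← mul_assoc, wedge_singleton, wedge_singleton, toDual_tmul_ι,
      toDual_tmul_ι, TrivSqZeroExt.inr_mul_inr, zero_mul]
  rw [hu, hv]
  rcases Int.units_eq_one_or u with rfl | rfl <;> rcases Int.units_eq_one_or v with rfl | rfl <;>
    simpa [Units.neg_smul, TensorProduct.tmul_neg] using h0

/-- `xᵢ ↦ x_{σ i}` on both parts of a dual number. -/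
def renameDual (𝕜 : Type*) [RCLike 𝕜] {n : ℕ} (σ : Equiv.Perm (Fin n)) :
    DualNumber (MvPolynomial (Fin n) 𝕜) →ₐ[𝕜] DualNumber (MvPolynomial (Fin n) 𝕜) :=
  DualNumber.lift ⟨((TrivSqZeroExt.inlAlgHom 𝕜 _ _).comp (rename σ), DualNumber.eps),
    DualNumber.eps_mul_eps, fun _ => Commute.all _ _⟩

lemma renameDual_apply (σ : Equiv.Perm (Fin n)) (z : DualNumber (MvPolynomial (Fin n) 𝕜)) :
    renameDual 𝕜 σ z = TrivSqZeroExt.inl (rename σ z.fst) + TrivSqZeroExt.inr (rename σ z.snd) := by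
  rw [renameDual, DualNumber.lift_apply_apply]
  simp [DualNumber.inr_eq_smul_eps, TrivSqZeroExt.inl_mul_eq_smul]

lemma toDual_permAct (σ : Equiv.Perm (Fin n)) (ω : Form 𝕜 n) :
    toDual 𝕜 n (permAct 𝕜 σ ω) = renameDual 𝕜 σ (toDual 𝕜 n ω) := by
  suffices h : (toDual 𝕜 n).comp (permAct 𝕜 σ) = (renameDual 𝕜 σ).comp (toDual 𝕜 n) from
    DFunLike.congr_fun h ω
  refine Algebra.TensorProduct.ext ?_ ?_
  · refine MvPolynomial.algHom_ext fun i => ?_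
    simp [permAct_tmul_one, toDual_tmul_one, renameDual_apply]
  · refine ExteriorAlgebra.hom_ext ((Pi.basisFun 𝕜 (Fin n)).ext fun i => ?_)
    simp [permAct_tmul_ι, toDual_tmul_ι, renameDual_apply]

lemma isHomogeneous_toDual {m : ℕ} {ω : Form 𝕜 n} (hω : ω ∈ homogeneous 𝕜 n m) :
    (toDual 𝕜 n ω).fst.IsHomogeneous m ∧ (toDual 𝕜 n ω).snd.IsHomogeneous m := by
  refine Submodule.span_induction (p := fun ω _ => (toDual 𝕜 n ω).fst.IsHomogeneous m ∧
    (toDual 𝕜 n ω).snd.IsHomogeneous m) ?_ ?_ ?_ ?_ hω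
  · rintro _ ⟨⟨a, K⟩, hb, rfl⟩
    have hb : a.degree + K.card = m := hb
    rw [monomialBasis_apply]
    have hmon : (monomial a (1 : 𝕜)).IsHomogeneous a.degree := isHomogeneous_monomial _ rfl
    rcases Nat.lt_or_ge K.card 2 with h | h
    · rcases Nat.lt_or_ge K.card 1 with h' | h'
      · obtain rfl : K = ∅ := Finset.card_eq_zero.1 (by omega)
        rw [Finset.card_empty, add_zero] at hb
        rw [wedge_empty, toDual_tmul_one, ← hb]
        exact ⟨by simpa using hmon, by simpa using isHomogeneous_zero _ _ _⟩
      · obtain ⟨i, rfl⟩ := Finset.card_eq_one.1 (show K.card = 1 by omega)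
        rw [Finset.card_singleton] at hb
        rw [wedge_singleton, toDual_tmul_ι, ← hb]
        exact ⟨by simpa using isHomogeneous_zero _ _ _,
          by simpa using hmon.mul (isHomogeneous_X 𝕜 i)⟩
    · rw [toDual_tmul_wedge _ h]
      exact ⟨isHomogeneous_zero _ _ _, isHomogeneous_zero _ _ _⟩
  · rw [map_zero]
    exact ⟨isHomogeneous_zero _ _ _, isHomogeneous_zero _ _ _⟩
  · intro x y _ _ hx hy
    rw [map_add]
    exact ⟨hx.1.add hy.1, hx.2.add hy.2⟩
  · intro c x _ hx
    rw [map_smul]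
    exact ⟨(homogeneousSubmodule _ _ m).smul_mem c hx.1, (homogeneousSubmodule _ _ m).smul_mem c hx.2⟩

/-- The ideal of polynomials generated by the homogeneous symmetric polynomials of positive
degree. -/
def hilbertIdeal (𝕜 : Type*) [RCLike 𝕜] (n : ℕ) : Ideal (MvPolynomial (Fin n) 𝕜) :=
  Ideal.span {f | (∀ σ : Equiv.Perm (Fin n), rename σ f = f) ∧ ∃ m, 0 < m ∧ f.IsHomogeneous m}

lemma toDual_mem_hilbertIdeal {η : Form 𝕜 n} (hη : η ∈ invariantIdeal 𝕜 n) :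
    (toDual 𝕜 n η).fst ∈ hilbertIdeal 𝕜 n ∧ (toDual 𝕜 n η).snd ∈ hilbertIdeal 𝕜 n := by
  let L : Ideal (DualNumber (MvPolynomial (Fin n) 𝕜)) :=
    { carrier := {z | z.fst ∈ hilbertIdeal 𝕜 n ∧ z.snd ∈ hilbertIdeal 𝕜 n}
      add_mem' := fun hx hy => ⟨Ideal.add_mem _ hx.1 hy.1, Ideal.add_mem _ hx.2 hy.2⟩
      zero_mem' := ⟨Ideal.zero_mem _, Ideal.zero_mem _⟩
      smul_mem' := fun c z hz => ⟨Ideal.mul_mem_left _ _ hz.1, by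
        rw [smul_eq_mul, DualNumber.snd_mul]
        exact Ideal.add_mem _ (Ideal.mul_mem_left _ _ hz.2) (Ideal.mul_mem_left _ _ hz.1)⟩ }
  have hle : invariantIdeal 𝕜 n ≤ L.toTwoSided.comap (toDual 𝕜 n) := by
    refine TwoSidedIdeal.span_le.2 ?_
    rintro η ⟨hinv, m, hm, hη⟩
    rw [SetLike.mem_coe, TwoSidedIdeal.mem_comap, Ideal.mem_toTwoSided]
    have hsym : ∀ σ, renameDual 𝕜 σ (toDual 𝕜 n η) = toDual 𝕜 n η := fun σ => by
      rw [← toDual_permAct, hinv σ]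
    obtain ⟨h₁, h₂⟩ := isHomogeneous_toDual hη
    refine ⟨Ideal.subset_span ⟨fun σ => ?_, m, hm, h₁⟩, Ideal.subset_span ⟨fun σ => ?_, m, hm, h₂⟩⟩
    · simpa [renameDual_apply] using congrArg TrivSqZeroExt.fst (hsym σ)
    · simpa [renameDual_apply] using congrArg TrivSqZeroExt.snd (hsym σ)
  have := hle hη
  rwa [TwoSidedIdeal.mem_comap, Ideal.mem_toTwoSided] at this

/-! ### The inner product -/

/-- The inner product with a fixed second argument, as a conjugate-linear map. -/
def innerMap (ω : Form 𝕜 n) : Form 𝕜 n →ₛₗ[starRingEnd 𝕜] 𝕜 where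
  toFun η := innerProd η ω
  map_add' η₁ η₂ := by
    simp only [innerProd, map_add, Finsupp.add_apply, star_add, mul_add, add_mul, Finsupp.sum,
      Finset.sum_add_distrib]
  map_smul' c η := by
    simp only [innerProd, map_smul, Finsupp.smul_apply, smul_eq_mul, star_mul', Finsupp.sum,
      Finset.mul_sum, starRingEnd_apply]
    exact Finset.sum_congr rfl fun _ _ => by ring

lemma innerMap_apply (ω η : Form 𝕜 n) : innerMap ω η = innerProd η ω := rfl

lemma innerMap_monomialBasis (ω : Form 𝕜 n) (b : (Fin n →₀ ℕ) × Finset (Fin n)) :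
    innerMap ω (monomialBasis 𝕜 n b) =
      ((∏ i, (b.1 i)! : ℕ) : 𝕜) * (monomialBasis 𝕜 n).repr ω b := by
  classical
  rw [innerMap_apply, innerProd, Module.Basis.repr_self, Finsupp.sum_eq_single b]
  · simp
  · intro b' _ hb
    simp [Finsupp.single_eq_of_ne hb]
  · simp

/-- The inner product on polynomials with a fixed second argument, as a conjugate-linear map. -/
def polyInner (g : MvPolynomial (Fin n) 𝕜) : MvPolynomial (Fin n) 𝕜 →ₛₗ[starRingEnd 𝕜] 𝕜 :=
  (innerMap (g ⊗ₜ[𝕜] 1)).comp ((TensorProduct.mk 𝕜 _ (ExteriorAlgebra 𝕜 (Fin n → 𝕜))).flip 1)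

lemma polyInner_monomial (g : MvPolynomial (Fin n) 𝕜) (a : Fin n →₀ ℕ) :
    polyInner g (monomial a 1) = ((∏ i, (a i)! : ℕ) : 𝕜) * coeff a g := by
  have h : (monomial a (1 : 𝕜)) ⊗ₜ[𝕜] 1 = monomialBasis 𝕜 n (a, ∅) := by
    rw [monomialBasis_apply, wedge_empty]
  rw [polyInner, LinearMap.comp_apply, LinearMap.flip_apply, TensorProduct.mk_apply, h,
    innerMap_monomialBasis, ← wedge_empty, monomialBasis_repr_tmul_wedge, if_pos rfl]

lemma polyInner_neg (g : MvPolynomial (Fin n) 𝕜) : polyInner (-g) = -polyInner g := by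
  refine (basisMonomials (Fin n) 𝕜).ext fun a => ?_
  rw [coe_basisMonomials, LinearMap.neg_apply, polyInner_monomial, polyInner_monomial, coeff_neg,
    mul_neg]

lemma innerMap_tmul_one (g : MvPolynomial (Fin n) 𝕜) (η : Form 𝕜 n) :
    innerMap (g ⊗ₜ[𝕜] 1) η = polyInner g (toDual 𝕜 n η).fst := by
  let T : Form 𝕜 n →ₗ[𝕜] MvPolynomial (Fin n) 𝕜 :=
    (TrivSqZeroExt.fstHom 𝕜 (MvPolynomial (Fin n) 𝕜) (MvPolynomial (Fin n) 𝕜)).toLinearMap ∘ₗ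
      (toDual 𝕜 n).toLinearMap
  suffices h : innerMap (g ⊗ₜ[𝕜] 1) = (polyInner g).comp T from DFunLike.congr_fun h η
  refine (monomialBasis 𝕜 n).ext fun ⟨a, K⟩ => ?_
  rw [innerMap_monomialBasis, ← wedge_empty, monomialBasis_repr_tmul_wedge, monomialBasis_apply]
  change _ = polyInner g (toDual 𝕜 n _).fst
  by_cases hK : K = ∅
  · subst hK
    rw [if_pos rfl, wedge_empty, toDual_tmul_one, TrivSqZeroExt.fst_inl, polyInner_monomial]
  · rw [if_neg (Ne.symm hK), mul_zero]
    rcases Nat.lt_or_ge K.card 2 with h | h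
    · have := Finset.card_pos.2 (Finset.nonempty_iff_ne_empty.2 hK)
      obtain ⟨i, rfl⟩ := Finset.card_eq_one.1 (show K.card = 1 by omega)
      rw [wedge_singleton, toDual_tmul_ι, TrivSqZeroExt.fst_inr, map_zero]
    · rw [toDual_tmul_wedge _ h, TrivSqZeroExt.fst_zero, map_zero]

lemma extDeriv_tmul_one (g : MvPolynomial (Fin n) 𝕜) :
    extDeriv 𝕜 n (g ⊗ₜ[𝕜] 1) = ∑ i, pderiv i g ⊗ₜ[𝕜] wedge 𝕜 {i} := by
  simp [extDeriv, wedge_singleton, LinearMap.sum_apply]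

lemma repr_extDeriv_tmul_one (g : MvPolynomial (Fin n) 𝕜) (b : (Fin n →₀ ℕ) × Finset (Fin n)) :
    (monomialBasis 𝕜 n).repr (extDeriv 𝕜 n (g ⊗ₜ[𝕜] 1)) b =
      ∑ i, if {i} = b.2 then coeff b.1 (pderiv i g) else 0 := by
  rw [extDeriv_tmul_one, map_sum, Finsupp.finsetSum_apply]
  simp only [monomialBasis_repr_tmul_wedge]

lemma prod_factorial_add_single (a : Fin n →₀ ℕ) (i : Fin n) :
    ∏ j, ((a + Finsupp.single i 1 : Fin n →₀ ℕ) j)! = (a i + 1) * ∏ j, (a j)! := by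
  rw [← Finset.mul_prod_erase _ _ (Finset.mem_univ i), 
    ← Finset.mul_prod_erase _ (fun j => (a j)!) (Finset.mem_univ i), ← mul_assoc]
  congr 1
  · simp [Nat.factorial_succ]
  · refine Finset.prod_congr rfl fun j hj => ?_
    rw [Finsupp.add_apply, Finsupp.single_eq_of_ne (Finset.ne_of_mem_erase hj), add_zero]

/-- Multiplication by `xᵢ` is adjoint to `∂/∂xᵢ`, and so the `ε`-part of `toDual` is adjoint
to the exterior derivative. -/
lemma innerMap_extDeriv_tmul_one (g : MvPolynomial (Fin n) 𝕜) (η : Form 𝕜 n) :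
    innerMap (extDeriv 𝕜 n (g ⊗ₜ[𝕜] 1)) η = polyInner g (toDual 𝕜 n η).snd := by
  let T : Form 𝕜 n →ₗ[𝕜] MvPolynomial (Fin n) 𝕜 :=
    (TrivSqZeroExt.sndHom (MvPolynomial (Fin n) 𝕜) (MvPolynomial (Fin n) 𝕜)).restrictScalars 𝕜 ∘ₗ
      (toDual 𝕜 n).toLinearMap
  suffices h : innerMap (extDeriv 𝕜 n (g ⊗ₜ[𝕜] 1)) = (polyInner g).comp T from
    DFunLike.congr_fun h η
  refine (monomialBasis 𝕜 n).ext fun ⟨a, K⟩ => ?_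
  rw [innerMap_monomialBasis, repr_extDeriv_tmul_one, monomialBasis_apply]
  change _ = polyInner g (toDual 𝕜 n _).snd
  by_cases hK : ∃ i, {i} = K
  · obtain ⟨i, rfl⟩ := hK
    rw [wedge_singleton, toDual_tmul_ι, TrivSqZeroExt.snd_inr, X, monomial_mul, one_mul,
      polyInner_monomial, prod_factorial_add_single]
    simp only [Finset.singleton_inj, Finset.sum_ite_eq', Finset.mem_univ, if_true, coeff_pderiv]
    push_cast
    ring
  · push Not at hK
    rw [Finset.sum_eq_zero fun i _ => if_neg (hK i), mul_zero]
    rcases Nat.lt_or_ge K.card 2 with h | h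
    · rcases Nat.lt_or_ge K.card 1 with h' | h'
      · obtain rfl : K = ∅ := Finset.card_eq_zero.1 (by omega)
        rw [wedge_empty, toDual_tmul_one, TrivSqZeroExt.snd_inl, map_zero]
      · obtain ⟨i, rfl⟩ := Finset.card_eq_one.1 (show K.card = 1 by omega)
        exact absurd rfl (hK i)
    · rw [toDual_tmul_wedge _ h, TrivSqZeroExt.snd_zero, map_zero]

lemma polyInner_rename (σ : Equiv.Perm (Fin n)) (f g : MvPolynomial (Fin n) 𝕜) :
    polyInner (rename σ g) (rename σ f) = polyInner g f := by
  suffices h : (polyInner (rename σ g)).comp (rename (R := 𝕜) σ).toLinearMap = polyInner g from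
    DFunLike.congr_fun h f
  refine (basisMonomials (Fin n) 𝕜).ext fun a => ?_
  rw [coe_basisMonomials, LinearMap.comp_apply, AlgHom.toLinearMap_apply, rename_monomial,
    polyInner_monomial, polyInner_monomial, coeff_rename_mapDomain _ σ.injective]
  congr 2
  rw [← Equiv.prod_comp σ]
  simp [Finsupp.mapDomain_apply σ.injective]

lemma polyInner_eq_zero {f g : MvPolynomial (Fin n) 𝕜} (h : ∀ a ∈ f.support, coeff a g = 0) :
    polyInner g f = 0 := by
  rw [f.as_sum, map_sum]
  refine Finset.sum_eq_zero fun a ha => ?_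
  have : monomial a (coeff a f) = coeff a f • monomial a (1 : 𝕜) := by
    rw [smul_monomial, smul_eq_mul, mul_one]
  rw [this, LinearMap.map_smulₛₗ, polyInner_monomial, h a ha, mul_zero, smul_zero]

/-! ### Harmonicity of the Vandermonde determinant -/

/-- The Vandermonde determinant `Δ` as a polynomial. -/
def vandermondePoly (𝕜 : Type*) [RCLike 𝕜] (n : ℕ) : MvPolynomial (Fin n) 𝕜 :=
  ∏ i : Fin n, ∏ j ∈ Finset.Ioi i, (X i - X j)

lemma vandermonde_eq : vandermonde 𝕜 n = vandermondePoly 𝕜 n ⊗ₜ[𝕜] 1 := rfl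

lemma vandermondePoly_ne_zero : vandermondePoly 𝕜 n ≠ 0 := by
  refine Finset.prod_ne_zero_iff.2 fun i _ => Finset.prod_ne_zero_iff.2 fun j hj => ?_
  rw [sub_ne_zero]
  exact fun h => (Finset.mem_Ioi.1 hj).ne (X_injective h)

lemma isHomogeneous_vandermondePoly : (vandermondePoly 𝕜 n).IsHomogeneous (n.choose 2) := by
  have h : (vandermondePoly 𝕜 n).IsHomogeneous (∑ i : Fin n, ∑ j ∈ Finset.Ioi i, 1) :=
    IsHomogeneous.prod _ _ _ fun i _ => IsHomogeneous.prod _ _ _ fun j _ =>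
      (isHomogeneous_X 𝕜 i).sub (isHomogeneous_X 𝕜 j)
  have : ∑ i : Fin n, ∑ j ∈ Finset.Ioi i, 1 = n.choose 2 := by
    simp only [Finset.sum_const, smul_eq_mul, mul_one, Fin.card_Ioi]
    rw [← sum_fin_val, ← Equiv.sum_comp Fin.revPerm]
    refine Finset.sum_congr rfl fun i _ => ?_
    rw [Fin.revPerm_apply, Fin.val_rev]
    omega
  rwa [this] at h

lemma rename_vandermondePoly (σ : Equiv.Perm (Fin n)) :
    rename σ (vandermondePoly 𝕜 n) = Equiv.Perm.sign σ • vandermondePoly 𝕜 n := by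
  have hdet : vandermondePoly 𝕜 n = (∏ i : Fin n, ∏ j ∈ Finset.Ioi i, (-1)) *
      (Matrix.vandermonde (X : Fin n → MvPolynomial (Fin n) 𝕜)).det := by
    rw [Matrix.det_vandermonde, vandermondePoly, ← Finset.prod_mul_distrib]
    refine Finset.prod_congr rfl fun i _ => ?_
    rw [← Finset.prod_mul_distrib]
    exact Finset.prod_congr rfl fun j _ => by ring
  have hσ : rename σ (Matrix.vandermonde (X : Fin n → MvPolynomial (Fin n) 𝕜)).det =
      Equiv.Perm.sign σ * (Matrix.vandermonde (X : Fin n → MvPolynomial (Fin n) 𝕜)).det := by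
    rw [← Matrix.det_permute, AlgHom.map_det]
    congr 1
    ext i j
    simp [Matrix.vandermonde_apply]
  rw [hdet, map_mul, hσ]
  simp only [map_prod, map_neg, map_one]
  rw [Units.smul_def, zsmul_eq_mul]
  ring

lemma val_le_of_strictMono {f : Fin n → ℕ} (hf : StrictMono f) (i : Fin n) : (i : ℕ) ≤ f i := by
  obtain ⟨k, hk⟩ := i
  induction k with
  | zero => exact Nat.zero_le _
  | succ k ih =>
    exact Nat.succ_le_of_lt ((ih (by omega)).trans_lt (hf (Fin.mk_lt_mk.2 (Nat.lt_succ_self k))))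

/-- Antisymmetric polynomials involve only monomials with distinct exponents, whose degree is at
least `0 + 1 + ⋯ + (n - 1)`. -/
lemma choose_two_le_degree {f : MvPolynomial (Fin n) 𝕜}
    (hf : ∀ σ : Equiv.Perm (Fin n), rename σ f = Equiv.Perm.sign σ • f) {a : Fin n →₀ ℕ}
    (ha : a ∈ f.support) : n.choose 2 ≤ a.degree := by
  have hinj : Function.Injective a := by
    intro i j hij
    by_contra hne
    have hmap : a.mapDomain (Equiv.swap i j) = a := by
      ext l
      rw [Finsupp.mapDomain_equiv_apply, Equiv.symm_swap]
      by_cases hi : l = i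
      · subst hi; rw [Equiv.swap_apply_left, hij]
      · by_cases hj : l = j
        · subst hj; rw [Equiv.swap_apply_right, hij]
        · rw [Equiv.swap_apply_of_ne_of_ne hi hj]
    have h := congrArg (coeff (a.mapDomain (Equiv.swap i j))) (hf (Equiv.swap i j))
    rw [coeff_rename_mapDomain _ (Equiv.injective _), hmap, Equiv.Perm.sign_swap hne,
      Units.neg_smul, one_smul, coeff_neg] at h
    exact mem_support_iff.1 ha (self_eq_neg.1 h)
  have hsum : ∑ i, a i = ∑ m ∈ Finset.univ.image a, m := by
    rw [Finset.sum_image fun _ _ _ _ h => hinj h]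
  have hcard : (Finset.univ.image a).card = n := by
    rw [Finset.card_image_of_injective _ hinj, Finset.card_fin]
  rw [Finsupp.degree_eq_sum, hsum, ← sum_fin_val,
    ← (Finset.univ.image a).sum_coe_sort fun m => m,
    ← ((Finset.univ.image a).orderIsoOfFin hcard).toEquiv.sum_comp]
  exact Finset.sum_le_sum fun i _ =>
    val_le_of_strictMono (f := fun i => ((Finset.univ.image a).orderIsoOfFin hcard i : ℕ))
      (fun i j hij => ((Finset.univ.image a).orderIsoOfFin hcard).strictMono hij) i

lemma polyInner_vandermonde_eq_zero {p : MvPolynomial (Fin n) 𝕜} (hp : p ∈ hilbertIdeal 𝕜 n) :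
    polyInner (vandermondePoly 𝕜 n) p = 0 := by
  suffices h : ∀ h, polyInner (vandermondePoly 𝕜 n) (p * h) = 0 by simpa using h 1
  refine Submodule.span_induction (p := fun p _ => ∀ h,
    polyInner (vandermondePoly 𝕜 n) (p * h) = 0) ?_ ?_ ?_ ?_ hp
  · rintro f ⟨hf, m, hm, hfm⟩ h
    -- Replace `h` by its antisymmetrization `u`; all monomials of `f * u` have degree `> C(n,2)`.
    set u := ∑ σ : Equiv.Perm (Fin n), Equiv.Perm.sign σ • rename σ h with hu
    have hanti : ∀ τ : Equiv.Perm (Fin n), rename τ u = Equiv.Perm.sign τ • u := by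
      intro τ
      rw [hu, map_sum, Finset.smul_sum]
      refine Fintype.sum_equiv (Equiv.mulLeft τ) _ _ fun σ => ?_
      rw [Equiv.coe_mulLeft, Equiv.Perm.sign_mul, smul_smul, ← mul_assoc, Int.units_mul_self,
        one_mul, Units.smul_def, Units.smul_def, map_zsmul, rename_rename]
      rfl
    have h₁ : polyInner (vandermondePoly 𝕜 n) (f * u) = 0 := by
      refine polyInner_eq_zero fun a ha => ?_
      obtain ⟨b, hb, c, hc, rfl⟩ := Finset.mem_add.1 (support_mul f u ha)
      have hbd : b.degree = m := by
        rw [Finsupp.degree_eq_weight_one]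
        exact hfm (mem_support_iff.1 hb)
      refine isHomogeneous_vandermondePoly.coeff_eq_zero ?_
      have := choose_two_le_degree hanti hc
      rw [map_add]
      omega
    have h₂ : polyInner (vandermondePoly 𝕜 n) (f * u) =
        Fintype.card (Equiv.Perm (Fin n)) • polyInner (vandermondePoly 𝕜 n) (f * h) := by
      rw [hu, Finset.mul_sum, map_sum, ← Finset.card_univ, ← Finset.sum_const]
      refine Finset.sum_congr rfl fun σ _ => ?_
      rw [← polyInner_rename σ (f * h), map_mul (rename (R := 𝕜) σ), hf σ, rename_vandermondePoly]
      rcases Int.units_eq_one_or (Equiv.Perm.sign σ) with hs | hs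
      · rw [hs, one_smul, one_smul]
      · rw [hs, Units.neg_smul, Units.neg_smul, one_smul, one_smul, mul_neg, map_neg, polyInner_neg]
        rfl
    rw [h₁, nsmul_eq_mul] at h₂
    exact (mul_eq_zero.1 h₂.symm).resolve_left (Nat.cast_ne_zero.2 Fintype.card_ne_zero)
  · intro h
    rw [zero_mul, map_zero]
  · intro x y _ _ hx hy h
    rw [add_mul, map_add, hx, hy, add_zero]
  · intro c x _ hx h
    rw [smul_eq_mul, mul_comm c x, mul_assoc, hx]

lemma mem_harmonic {ω : Form 𝕜 n} : ω ∈ harmonic 𝕜 n ↔ ∀ η ∈ invariantIdeal 𝕜 n, innerMap ω η = 0 :=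
  Iff.rfl

lemma vandermonde_mem_harmonic : vandermonde 𝕜 n ∈ harmonic 𝕜 n := by
  rw [mem_harmonic]
  intro η hη
  rw [vandermonde_eq, innerMap_tmul_one]
  exact polyInner_vandermonde_eq_zero (toDual_mem_hilbertIdeal hη).1

lemma extDeriv_vandermonde_mem_harmonic : extDeriv 𝕜 n (vandermonde 𝕜 n) ∈ harmonic 𝕜 n := by
  rw [mem_harmonic]
  intro η hη
  rw [vandermonde_eq, innerMap_extDeriv_tmul_one]
  exact polyInner_vandermonde_eq_zero (toDual_mem_hilbertIdeal hη).2

/-! ### Harmonic forms of top degree -/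

lemma innerMap_monomial_tmul_wedge (ω : Form 𝕜 n) (a : Fin n →₀ ℕ) (K : Finset (Fin n)) :
    innerMap ω (monomial a 1 ⊗ₜ[𝕜] wedge 𝕜 K) =
      ((∏ i, (a i)! : ℕ) : 𝕜) * (monomialBasis 𝕜 n).repr ω (a, K) := by
  rw [← monomialBasis_apply (a, K), innerMap_monomialBasis]

lemma prod_factorial_ne_zero (a : Fin n →₀ ℕ) : ((∏ i, (a i)! : ℕ) : 𝕜) ≠ 0 :=
  Nat.cast_ne_zero.2 (Finset.prod_ne_zero_iff.2 fun _ _ => Nat.factorial_ne_zero _)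

lemma repr_eq_zero_of_mem_annihilator {ω : Form 𝕜 n} (hω : ω ∈ harmonic 𝕜 n) {a : Fin n →₀ ℕ}
    {K : Finset (Fin n)} (h : monomial a 1 ∈ annihilator 𝕜 K) :
    (monomialBasis 𝕜 n).repr ω (a, K) = 0 := by
  have := mem_harmonic.1 hω _ (mem_annihilator.1 h)
  rw [innerMap_monomial_tmul_wedge] at this
  exact (mul_eq_zero.1 this).resolve_left (prod_factorial_ne_zero a)

/-- Harmonic forms have no terms of degree more than `C(n,2)`, and none of degree `C(n,2)` with two or
more differentials. -/
lemma repr_eq_zero_of_mem_harmonic {ω : Form 𝕜 n} (hω : ω ∈ harmonic 𝕜 n)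
    {b : (Fin n →₀ ℕ) × Finset (Fin n)}
    (hb : n.choose 2 < monomialDegree b ∨ (n.choose 2 ≤ monomialDegree b ∧ 2 ≤ b.2.card)) :
    (monomialBasis 𝕜 n).repr ω b = 0 := by
  obtain ⟨a, K⟩ := b
  obtain ⟨t, ht⟩ := (hasRelations_annihilator (𝕜 := 𝕜) K).exists_top
  refine repr_eq_zero_of_mem_annihilator hω ?_
  rcases hb with hb | ⟨hb, hK⟩
  · exact (ht a hb.le).2 (Or.inl hb)
  · exact (ht a hb).2 (Or.inr hK)

lemma repr_eq_zero_of_mem_homogeneous {m : ℕ} {ω : Form 𝕜 n} (hω : ω ∈ homogeneous 𝕜 n m)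
    {b : (Fin n →₀ ℕ) × Finset (Fin n)} (hb : monomialDegree b ≠ m) :
    (monomialBasis 𝕜 n).repr ω b = 0 := by
  by_contra h
  exact hb ((monomialBasis 𝕜 n).repr_support_subset_of_mem_span _ hω (Finsupp.mem_support_iff.2 h))

/-- In top degree the coefficients at `dx_K` of two harmonic forms are proportional, since the
annihilator of `dx_K` has codimension at most one there. -/
lemma exists_repr_eq_mul {ω η : Form 𝕜 n} (hω : ω ∈ harmonic 𝕜 n) (hη : η ∈ harmonic 𝕜 n)
    (hωm : ω ∈ homogeneous 𝕜 n (n.choose 2)) (hηm : η ∈ homogeneous 𝕜 n (n.choose 2))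
    {K : Finset (Fin n)} {a₀ : Fin n →₀ ℕ} (h0 : (monomialBasis 𝕜 n).repr η (a₀, K) ≠ 0) :
    ∃ c : 𝕜, ∀ a, (monomialBasis 𝕜 n).repr ω (a, K) = c * (monomialBasis 𝕜 n).repr η (a, K) := by
  obtain ⟨t, ht⟩ := (hasRelations_annihilator (𝕜 := 𝕜) K).exists_top
  have key : ∀ a : Fin n →₀ ℕ, n.choose 2 = a.degree + K.card → ∃ c : 𝕜, ∀ θ ∈ harmonic 𝕜 n,
      (monomialBasis 𝕜 n).repr θ (a, K) = c * (monomialBasis 𝕜 n).repr θ (t, K) := by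
    intro a ha
    obtain ⟨c, hc⟩ := (ht a ha.le).1
    refine ⟨((∏ i, (a i)! : ℕ) : 𝕜)⁻¹ * (star c * ((∏ i, (t i)! : ℕ) : 𝕜)), fun θ hθ => ?_⟩
    have := mem_harmonic.1 hθ _ (mem_annihilator.1 hc)
    rw [TensorProduct.sub_tmul, ← TensorProduct.smul_tmul', map_sub, LinearMap.map_smulₛₗ,
      innerMap_monomial_tmul_wedge, innerMap_monomial_tmul_wedge, sub_eq_zero] at this
    rw [mul_assoc, eq_inv_mul_iff_mul_eq₀ (prod_factorial_ne_zero a), this, smul_eq_mul, mul_assoc]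
    rfl
  have hdeg : n.choose 2 = a₀.degree + K.card := by
    by_contra h
    exact h0 (repr_eq_zero_of_mem_homogeneous hηm (Ne.symm h))
  obtain ⟨c₀, hc₀⟩ := key a₀ hdeg
  have ht0 : (monomialBasis 𝕜 n).repr η (t, K) ≠ 0 := by
    intro h
    rw [hc₀ η hη, h, mul_zero] at h0
    exact h0 rfl
  refine ⟨(monomialBasis 𝕜 n).repr ω (t, K) / (monomialBasis 𝕜 n).repr η (t, K), fun a => ?_⟩
  by_cases ha : n.choose 2 = a.degree + K.card
  · obtain ⟨c, hc⟩ := key a ha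
    rw [hc ω hω, hc η hη]
    field_simp
  · have ha' : monomialDegree (a, K) ≠ n.choose 2 := Ne.symm ha
    rw [repr_eq_zero_of_mem_homogeneous hωm ha', repr_eq_zero_of_mem_homogeneous hηm ha', mul_zero]

lemma vandermonde_mem_homogeneous : vandermonde 𝕜 n ∈ homogeneous 𝕜 n (n.choose 2) := by
  have := tmul_wedge_mem_homogeneous (𝕜 := 𝕜) (isHomogeneous_vandermondePoly (n := n)) ∅
  rwa [wedge_empty] at this

lemma extDeriv_vandermonde_mem_homogeneous (hn : 2 ≤ n) :
    extDeriv 𝕜 n (vandermonde 𝕜 n) ∈ homogeneous 𝕜 n (n.choose 2) := by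
  rw [vandermonde_eq, extDeriv_tmul_one]
  refine Submodule.sum_mem _ fun i _ => ?_
  have := tmul_wedge_mem_homogeneous (𝕜 := 𝕜)
    ((isHomogeneous_vandermondePoly (𝕜 := 𝕜) (n := n)).pderiv (i := i)) {i}
  rwa [Finset.card_singleton, Nat.sub_add_cancel (Nat.choose_pos hn)] at this

lemma repr_vandermonde (b : (Fin n →₀ ℕ) × Finset (Fin n)) :
    (monomialBasis 𝕜 n).repr (vandermonde 𝕜 n) b =
      if ∅ = b.2 then coeff b.1 (vandermondePoly 𝕜 n) else 0 := by
  rw [vandermonde_eq, ← wedge_empty, monomialBasis_repr_tmul_wedge]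

lemma repr_extDeriv_vandermonde_singleton (a : Fin n →₀ ℕ) (i : Fin n) :
    (monomialBasis 𝕜 n).repr (extDeriv 𝕜 n (vandermonde 𝕜 n)) (a, {i}) =
      coeff a (pderiv i (vandermondePoly 𝕜 n)) := by
  rw [vandermonde_eq, repr_extDeriv_tmul_one]
  simp

lemma repr_extDeriv_vandermonde_of_card_ne (a : Fin n →₀ ℕ) {K : Finset (Fin n)}
    (hK : K.card ≠ 1) :
    (monomialBasis 𝕜 n).repr (extDeriv 𝕜 n (vandermonde 𝕜 n)) (a, K) = 0 := by
  rw [vandermonde_eq, repr_extDeriv_tmul_one]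
  refine Finset.sum_eq_zero fun i _ => if_neg ?_
  rintro rfl
  exact hK (Finset.card_singleton i)

/-- Orthogonality of a harmonic form to the multiples of the invariant `∑ dxᵢ`. -/
lemma sum_repr_singleton_eq_zero {ω : Form 𝕜 n} (hω : ω ∈ harmonic 𝕜 n) (a : Fin n →₀ ℕ) :
    ∑ i, (monomialBasis 𝕜 n).repr ω (a, {i}) = 0 := by
  have h := (invariantIdeal 𝕜 n).mul_mem_left (monomial a 1 ⊗ₜ 1) _ (sum_X_pow_tmul_mem 0)
  simp_rw [pow_zero, Finset.mul_sum, Algebra.TensorProduct.tmul_mul_tmul, mul_one, one_mul,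
    ← wedge_singleton] at h
  have := mem_harmonic.1 hω _ h
  rw [map_sum] at this
  simp_rw [innerMap_monomial_tmul_wedge, ← Finset.mul_sum] at this
  exact (mul_eq_zero.1 this).resolve_left (prod_factorial_ne_zero a)

lemma sum_pderiv_vandermondePoly : ∑ i, pderiv i (vandermondePoly 𝕜 n) = 0 := by
  ext a
  rw [coeff_sum, coeff_zero, ← sum_repr_singleton_eq_zero
    (extDeriv_vandermonde_mem_harmonic (𝕜 := 𝕜) (n := n)) a]
  exact Finset.sum_congr rfl fun i _ => (repr_extDeriv_vandermonde_singleton a i).symm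

lemma pderiv_vandermondePoly_rename (σ : Equiv.Perm (Fin n)) (i : Fin n) :
    rename σ (pderiv i (vandermondePoly 𝕜 n)) =
      Equiv.Perm.sign σ • pderiv (σ i) (vandermondePoly 𝕜 n) := by
  rw [← pderiv_rename σ.injective, rename_vandermondePoly, Units.smul_def, map_zsmul,
    Units.smul_def]

lemma rename_swap_pderiv_vandermondePoly {i j : Fin n} (hij : i ≠ j) (l : Fin n) :
    rename (Equiv.swap i j) (pderiv l (vandermondePoly 𝕜 n)) =
      -pderiv (Equiv.swap i j l) (vandermondePoly 𝕜 n) := by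
  rw [pderiv_vandermondePoly_rename, Equiv.Perm.sign_swap hij, Units.neg_smul, one_smul]

/-- If one partial derivative vanished, all would by antisymmetry, against Euler's identity. -/
lemma pderiv_vandermondePoly_ne_zero (hn : 2 ≤ n) (i : Fin n) :
    pderiv i (vandermondePoly 𝕜 n) ≠ 0 := by
  intro h
  have hall : ∀ j, pderiv j (vandermondePoly 𝕜 n) = 0 := by
    intro j
    by_cases hij : i = j
    · rw [← hij, h]
    · have := rename_swap_pderiv_vandermondePoly (𝕜 := 𝕜) hij i
      rw [h, map_zero, Equiv.swap_apply_left] at this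
      exact neg_eq_zero.1 this.symm
  have heuler := (isHomogeneous_vandermondePoly (𝕜 := 𝕜) (n := n)).sum_X_mul_pderiv
  simp only [hall, mul_zero, Finset.sum_const_zero] at heuler
  have := smul_eq_zero.1 heuler.symm
  exact this.elim (Nat.choose_pos hn).ne' vandermondePoly_ne_zero

/-- If two partial derivatives agreed, all would by antisymmetry, and their sum is zero. -/
lemma pderiv_vandermondePoly_ne (hn : 2 ≤ n) {i j : Fin n} (hij : i ≠ j) :
    pderiv i (vandermondePoly 𝕜 n) ≠ pderiv j (vandermondePoly 𝕜 n) := by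
  intro h
  have hall : ∀ l, pderiv l (vandermondePoly 𝕜 n) = pderiv i (vandermondePoly 𝕜 n) := by
    intro l
    by_cases hli : l = i
    · rw [hli]
    by_cases hlj : l = j
    · rw [hlj, h]
    have := congrArg (rename (Equiv.swap j l)) h
    rw [rename_swap_pderiv_vandermondePoly (Ne.symm hlj),
      rename_swap_pderiv_vandermondePoly (Ne.symm hlj), neg_inj, Equiv.swap_apply_left,
      Equiv.swap_apply_of_ne_of_ne hij (Ne.symm hli)] at this
    exact this.symm
  have hsum := sum_pderiv_vandermondePoly (𝕜 := 𝕜) (n := n)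
  simp only [hall, Finset.sum_const, Finset.card_univ, Fintype.card_fin] at hsum
  exact (smul_eq_zero.1 hsum).elim (by omega) (pderiv_vandermondePoly_ne_zero hn i)

/-- Up to scalars, `∑ ∂Δ/∂xᵢ = 0` is the only linear relation between the partial derivatives of
`Δ`: a relation minus its image under the transposition of `i` and `j` is
`(c i - c j) (∂Δ/∂xᵢ - ∂Δ/∂xⱼ) = 0`. -/
lemma eq_of_sum_smul_pderiv_eq_zero (hn : 2 ≤ n) {c : Fin n → 𝕜}
    (hc : ∑ i, c i • pderiv i (vandermondePoly 𝕜 n) = 0) (i j : Fin n) : c i = c j := by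
  by_cases hij : i = j
  · rw [hij]
  have h := congrArg (rename (Equiv.swap i j)) hc
  simp only [map_sum, map_smul, rename_swap_pderiv_vandermondePoly hij, map_zero, smul_neg,
    Finset.sum_neg_distrib, neg_eq_zero] at h
  rw [← Equiv.sum_comp (Equiv.swap i j)] at h
  simp only [Equiv.swap_apply_self] at h
  have hd : ∑ l, (c l - c (Equiv.swap i j l)) • pderiv l (vandermondePoly 𝕜 n) = 0 := by
    simp only [sub_smul, Finset.sum_sub_distrib, hc, h, sub_zero]
  rw [← Finset.add_sum_erase _ _ (Finset.mem_univ i),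
    ← Finset.add_sum_erase _ _ (Finset.mem_erase.2 ⟨Ne.symm hij, Finset.mem_univ j⟩),
    Finset.sum_eq_zero, Equiv.swap_apply_left, Equiv.swap_apply_right, add_zero,
    ← neg_sub (c i) (c j), neg_smul, ← sub_eq_add_neg, ← smul_sub] at hd
  · exact sub_eq_zero.1 ((smul_eq_zero.1 hd).resolve_right
      (sub_ne_zero.2 (pderiv_vandermondePoly_ne hn hij)))
  · intro l hl
    rw [Finset.mem_erase, Finset.mem_erase] at hl
    rw [Equiv.swap_apply_of_ne_of_ne hl.2.1 hl.1, sub_self, zero_smul]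

/-- A harmonic form of top degree is a combination of `Δ` and the `∂Δ/∂xᵢ dxᵢ`; orthogonality to
`∑ dxᵢ` makes the coefficients of the latter equal. -/
lemma exists_eq_smul_add_smul (hn : 2 ≤ n) {ω : Form 𝕜 n} (hω : ω ∈ harmonic 𝕜 n)
    (hωm : ω ∈ homogeneous 𝕜 n (n.choose 2)) :
    ∃ r s : 𝕜, ω = r • vandermonde 𝕜 n + s • extDeriv 𝕜 n (vandermonde 𝕜 n) := by
  obtain ⟨a₀, ha₀⟩ := ne_zero_iff.1 (vandermondePoly_ne_zero (𝕜 := 𝕜) (n := n))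
  obtain ⟨r, hr⟩ := exists_repr_eq_mul (K := ∅) (a₀ := a₀) hω vandermonde_mem_harmonic hωm
    vandermonde_mem_homogeneous (by rwa [repr_vandermonde, if_pos rfl])
  have hs : ∀ i, ∃ s : 𝕜, ∀ a, (monomialBasis 𝕜 n).repr ω (a, {i}) =
      s * coeff a (pderiv i (vandermondePoly 𝕜 n)) := by
    intro i
    obtain ⟨a₁, ha₁⟩ := ne_zero_iff.1 (pderiv_vandermondePoly_ne_zero (𝕜 := 𝕜) hn i)
    simp_rw [← repr_extDeriv_vandermonde_singleton]
    exact exists_repr_eq_mul (a₀ := a₁) hω extDeriv_vandermonde_mem_harmonic hωm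
      (extDeriv_vandermonde_mem_homogeneous hn) (by rwa [repr_extDeriv_vandermonde_singleton])
  choose s hs using hs
  have hrel : ∑ i, s i • pderiv i (vandermondePoly 𝕜 n) = 0 := by
    ext a
    rw [coeff_sum, coeff_zero, ← sum_repr_singleton_eq_zero hω a]
    exact Finset.sum_congr rfl fun i _ => by rw [coeff_smul, hs, smul_eq_mul]
  have heq := eq_of_sum_smul_pderiv_eq_zero hn hrel
  refine ⟨r, s ⟨0, by omega⟩, (monomialBasis 𝕜 n).repr.injective (Finsupp.ext fun ⟨a, K⟩ => ?_)⟩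
  rw [map_add, map_smul, map_smul, Finsupp.add_apply, Finsupp.smul_apply, Finsupp.smul_apply,
    smul_eq_mul, smul_eq_mul]
  rcases Nat.lt_or_ge K.card 2 with h | h
  · rcases Nat.lt_or_ge K.card 1 with h' | h'
    · obtain rfl : K = ∅ := Finset.card_eq_zero.1 (by omega)
      rw [hr, repr_extDeriv_vandermonde_of_card_ne _ (by simp), mul_zero, add_zero]
    · obtain ⟨i, rfl⟩ := Finset.card_eq_one.1 (show K.card = 1 by omega)
      rw [hs, repr_extDeriv_vandermonde_singleton, repr_vandermonde,
        if_neg (Finset.singleton_ne_empty i).symm, mul_zero, zero_add, heq i]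
  · have hK : ∅ ≠ K := by
      rintro rfl
      simp at h
    rw [repr_vandermonde, if_neg hK, repr_extDeriv_vandermonde_of_card_ne _ (by omega), mul_zero,
      mul_zero, add_zero]
    by_cases hd : monomialDegree (a, K) = n.choose 2
    · exact repr_eq_zero_of_mem_harmonic hω (Or.inr ⟨hd.ge, h⟩)
    · exact repr_eq_zero_of_mem_homogeneous hωm hd

lemma linearIndependent_vandermonde (hn : 2 ≤ n) :
    LinearIndependent 𝕜 ![vandermonde 𝕜 n, extDeriv 𝕜 n (vandermonde 𝕜 n)] := by
  rw [LinearIndependent.pair_iff]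
  intro r s h
  have hrepr : ∀ b, r * (monomialBasis 𝕜 n).repr (vandermonde 𝕜 n) b +
      s * (monomialBasis 𝕜 n).repr (extDeriv 𝕜 n (vandermonde 𝕜 n)) b = 0 := fun b => by
    simpa using DFunLike.congr_fun (congrArg (monomialBasis 𝕜 n).repr h) b
  obtain ⟨a₀, ha₀⟩ := ne_zero_iff.1 (vandermondePoly_ne_zero (𝕜 := 𝕜) (n := n))
  obtain ⟨a₁, ha₁⟩ := ne_zero_iff.1 (pderiv_vandermondePoly_ne_zero (𝕜 := 𝕜) hn ⟨0, by omega⟩)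
  have h₀ := hrepr (a₀, ∅)
  have h₁ := hrepr (a₁, {⟨0, by omega⟩})
  rw [repr_vandermonde, if_pos rfl, repr_extDeriv_vandermonde_of_card_ne _ (by simp), mul_zero,
    add_zero] at h₀
  rw [repr_vandermonde, if_neg (Finset.singleton_ne_empty _).symm,
    repr_extDeriv_vandermonde_singleton, mul_zero, zero_add] at h₁
  exact ⟨(mul_eq_zero.1 h₀).resolve_right ha₀, (mul_eq_zero.1 h₁).resolve_right ha₁⟩

end PolyForm

end

theorem corollary20 {𝕜 : Type*} [RCLike 𝕜] (n : ℕ) :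
    (∀ ω ∈ PolyForm.harmonic 𝕜 n, PolyForm.totalDegree ω ≤ n.choose 2) ∧
    (2 ≤ n →
      Module.finrank 𝕜
        ↥(PolyForm.harmonic 𝕜 n ⊓ PolyForm.homogeneous 𝕜 n (n.choose 2)) = 2 ∧
      ∃ b : Module.Basis (Fin 2) 𝕜
          ↥(PolyForm.harmonic 𝕜 n ⊓ PolyForm.homogeneous 𝕜 n (n.choose 2)),
        (b 0 : PolyForm.Form 𝕜 n) = PolyForm.vandermonde 𝕜 n ∧
        (b 1 : PolyForm.Form 𝕜 n) =
          PolyForm.extDeriv 𝕜 n (PolyForm.vandermonde 𝕜 n)) := by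
  refine ⟨fun ω hω => Finset.sup_le fun b hb => ?_, fun hn => ?_⟩
  · by_contra h
    exact Finsupp.mem_support_iff.1 hb
      (PolyForm.repr_eq_zero_of_mem_harmonic hω (Or.inl (not_le.1 h)))
  · let V := PolyForm.harmonic 𝕜 n ⊓ PolyForm.homogeneous 𝕜 n (n.choose 2)
    let v : Fin 2 → V :=
      ![⟨PolyForm.vandermonde 𝕜 n, PolyForm.vandermonde_mem_harmonic,
          PolyForm.vandermonde_mem_homogeneous⟩,
        ⟨PolyForm.extDeriv 𝕜 n (PolyForm.vandermonde 𝕜 n),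
          PolyForm.extDeriv_vandermonde_mem_harmonic,
          PolyForm.extDeriv_vandermonde_mem_homogeneous hn⟩]
    have hli : LinearIndependent 𝕜 v := by
      refine LinearIndependent.of_comp V.subtype ?_
      convert PolyForm.linearIndependent_vandermonde (𝕜 := 𝕜) hn using 1
      ext i
      fin_cases i <;> rfl
    have hsp : ⊤ ≤ Submodule.span 𝕜 (Set.range v) := by
      rintro ⟨ω, hω, hωm⟩ -
      obtain ⟨r, s, hrs⟩ := PolyForm.exists_eq_smul_add_smul hn hω hωm
      have : (⟨ω, hω, hωm⟩ : V) = r • v 0 + s • v 1 := Subtype.ext hrs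
      rw [this]
      exact Submodule.add_mem _ (Submodule.smul_mem _ _ (Submodule.subset_span ⟨0, rfl⟩))
        (Submodule.smul_mem _ _ (Submodule.subset_span ⟨1, rfl⟩))
    let b := Module.Basis.mk hli hsp
    refine ⟨?_, b, ?_, ?_⟩
    · rw [Module.finrank_eq_card_basis b, Fintype.card_fin]
    · rw [Module.Basis.mk_apply]
      rfl
    · rw [Module.Basis.mk_apply]
      rfl
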